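/- **Setting.** Let $\alpha,\eta,\theta,R$ be real $N\times N$ matrices with $\alpha^{T}=\alpha>0$, $\eta^{T}=\eta\ge 0$, $\theta^{T}=-\theta$, $R^{T}=R\ge 0$ and $N_R:=\operatorname{rank}R>0$. On $H=\mathbb{C}^{2N}=\mathbb C^N\oplus\mathbb C^N$ with the standard inner product put $$\Omega=\begin{bmatrix}-2\mathrm{i}K_p\theta K_p^{T}&-\mathrm{i}\Phi^{T}\\ \mathrm{i}\Phi&0\end{bmatrix},\quad B=\begin{bmatrix}K_pRK_p^{T}&0\\0&0\end{bmatrix},\quad K_p=\sqrt{\alpha}^{\,-1},\ \Phi=\sqrt{\eta}\,K_p^{T},\quad A(\beta)=\Omega-\mathrm{i}\beta B .$$ Let $\omega_{\max}$ be the largest eigenvalue of $\Omega$, $b_{\min}$ the smallest nonzero eigenvalue of $B$, and $P_B^{\perp}$ the orthogonal projection onto $\operatorname{Ker}B$. Write $D(z;r)=\{\lambda\in\mathbb C:|\lambda-z|\le r\}$, and $$c(\beta)=\frac{2\omega_{\max}^2}{b_{\min}}\Big(\beta-\frac{2\omega_{\max}}{b_{\min}}\Big)^{-1}\ \Big(\beta>\tfrac{2\omega_{\max}}{b_{\min}}\Big),\qquad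 c^{-1}(y)=\frac{2\omega_{\max}^2}{b_{\min}}\,y^{-1}+\frac{2\omega_{\max}}{b_{\min}}\ (y>0),$$ $$\sigma_0(A(\beta))=\sigma(A(\beta))\cap D(0;\omega_{\max}),\qquad \sigma_1(A(\beta))=\sigma(A(\beta))\cap\bigcup_{0\ne b\in\sigma(B)}D(-\mathrm{i}\beta b;\omega_{\max}).$$ **Theorem (modal dichotomy II).** Assume $N_R<N$ and $P_B^{\perp}\Omega P_B^{\perp}\neq 0$, let $\rho_{\min}$ be the smallest positive eigenvalue of $P_B^{\perp}\Omega P_B^{\perp}$, and let $\beta>c^{-1}(\rho_{\min}/2)$. Then $\beta>2\omega_{\max}/b_{\min}$, $c(\beta)<\rho_{\min}/2\le\omega_{\max}/2$, and the following hold. 1. $\sigma(A(\beta))$ is the disjoint union of $\sigma_0(A(\beta))$ and $\sigma_1(A(\beta))$, and there are unique $A(\beta)$-invariant subspaces $H_{h\ell},H_{\ell\ell}$ with $H=H_{h\ell}\oplus H_{\ell\ell}$, $\sigma(A(\beta)|_{H_{\ell\ell}})=\sigma_0(A(\beta))$ and $\sigma(A(\beta)|_{H_{h\ell}})=\sigma_1(A(\beta))$.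 Moreover $\dim H_{h\ell}=N_R$ and $\dim H_{\ell\ell}=2N-N_R$. 2. $\sigma(A(\beta)|_{H_{\ell\ell}})=\{\zeta\in\sigma(A(\beta)):0\le-\operatorname{Im}\zeta\le\omega_{\max}\}$ and $\sigma(A(\beta)|_{H_{h\ell}})=\{\zeta\in\sigma(A(\beta)):-\operatorname{Im}\zeta\ge\beta b_{\min}-\omega_{\max}\}$, where $\beta b_{\min}-\omega_{\max}>\omega_{\max}$; and for $\zeta\in\sigma(A(\beta)|_{H_{h\ell}})$, $$\frac12\frac{|\operatorname{Re}\zeta|}{-\operatorname{Im}\zeta}\le\frac12\frac{\omega_{\max}}{\beta b_{\min}-\omega_{\max}}<\frac12 .$$ 3. For every $\zeta\in\sigma(A(\beta)|_{H_{\ell\ell}})$: $\min_{\rho\in\sigma(P_B^\perp\Omega P_B^\perp)}|\zeta-\rho|\le c(\beta)$, $\min_{\rho\in\sigma(P_B^\perp\Omega P_B^\perp)}|\operatorname{Re}\zeta-\rho|\le c(\beta)$ and $0\le-\operatorname{Im}\zeta\le c(\beta)$. 4. There are unique $A(\beta)$-invariant subspaces $H_{\ell\ell,0},H_{\ell\ell,1}$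 with $H_{\ell\ell}=H_{\ell\ell,0}\oplus H_{\ell\ell,1}$, $$\sigma(A(\beta)|_{H_{\ell\ell,0}})=\sigma(A(\beta))\cap D(0;c(\beta)),\qquad \sigma(A(\beta)|_{H_{\ell\ell,1}})=\sigma(A(\beta))\cap\bigcup_{0\ne\rho\in\sigma(P_B^{\perp}\Omega P_B^{\perp})}D(\rho;c(\beta)).$$ Furthermore $\sigma(A(\beta)|_{H_{\ell\ell,1}})=\sigma(A(\beta))\cap\{\rho_{\min}/2<|\zeta|\le\omega_{\max}\}$ and $\sigma(A(\beta)|_{H_{\ell\ell,0}})=\sigma(A(\beta))\cap\{|\zeta|<\rho_{\min}/2\}$. 5. $\dim H_{\ell\ell,1}=\operatorname{rank}(P_B^{\perp}\Omega P_B^{\perp})$ and $\dim H_{\ell\ell,0}=2N-N_R-\dim H_{\ell\ell,1}$. If $\operatorname{Ker}R\cap\operatorname{Ker}\eta=\{0\}$, then $\dim H_{\ell\ell,1}=2(N-N_R)$. -/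

import Mathlib

noncomputable section

/-- The Hilbert space `ℂ^N ⊕ ℂ^N = ℂ^(2N)` with its standard inner product. -/
abbrev PhaseSpace (N : ℕ) : Type := EuclideanSpace ℂ (Fin N ⊕ Fin N)

open scoped MatrixOrder Matrix.Norms.L2Operator in
/-- The positive semidefinite square root of a real positive semidefinite matrix. -/
def psdSqrt {N : ℕ} (M : Matrix (Fin N) (Fin N) ℝ) : Matrix (Fin N) (Fin N) ℝ :=
  CFC.sqrt M

/-- The data of the Lagrangian system `α Q'' + (2 θ + β R) Q' + η Q = 0`: real `N × N` matrices with
`α` symmetric positive definite, `η` and `R` symmetric positive semidefinite, `θ` skew-symmetric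
and `R ≠ 0`. -/
structure LagrangianSystem (N : ℕ) where
  α : Matrix (Fin N) (Fin N) ℝ
  η : Matrix (Fin N) (Fin N) ℝ
  θ : Matrix (Fin N) (Fin N) ℝ
  R : Matrix (Fin N) (Fin N) ℝ
  α_posDef : α.PosDef
  η_posSemidef : η.PosSemidef
  θ_skew : θ.transpose = -θ
  R_posSemidef : R.PosSemidef
  rank_R_pos : 0 < R.rank

namespace LagrangianSystem

variable {N : ℕ} (S : LagrangianSystem N)

/-- `K_p = (√α)⁻¹`. -/
def Kp : Matrix (Fin N) (Fin N) ℝ := (psdSqrt S.α)⁻¹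

/-- `K_q = √η`. -/
def Kq : Matrix (Fin N) (Fin N) ℝ := psdSqrt S.η

/-- `Φ = K_q K_pᵀ`. -/
def Phi : Matrix (Fin N) (Fin N) ℝ := S.Kq * S.Kp.transpose

/-- The matrix `[[-2i K_p θ K_pᵀ, -i Φᵀ], [i Φ, 0]]`. -/
def OmegaMatrix : Matrix (Fin N ⊕ Fin N) (Fin N ⊕ Fin N) ℂ :=
  Matrix.fromBlocks
    ((-(2 * Complex.I)) • (S.Kp * S.θ * S.Kp.transpose).map Complex.ofReal)
    ((-Complex.I) • S.Phi.transpose.map Complex.ofReal)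
    (Complex.I • S.Phi.map Complex.ofReal)
    0

/-- The matrix `[[K_p R K_pᵀ, 0], [0, 0]]`. -/
def BMatrix : Matrix (Fin N ⊕ Fin N) (Fin N ⊕ Fin N) ℂ :=
  Matrix.fromBlocks ((S.Kp * S.R * S.Kp.transpose).map Complex.ofReal) 0 0 0

/-- The frequency operator `Ω` on `ℂ^(2N)`. -/
def Omega : Module.End ℂ (PhaseSpace N) := Matrix.toEuclideanLin S.OmegaMatrix

/-- The dissipation operator `B` on `ℂ^(2N)`. -/
def B : Module.End ℂ (PhaseSpace N) := Matrix.toEuclideanLin S.BMatrix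

/-- The system operator `A(β) = Ω - i β B`. -/
def A (β : ℝ) : Module.End ℂ (PhaseSpace N) := S.Omega - (Complex.I * (β : ℂ)) • S.B

/-- `P_B^⊥`: the orthogonal projection of `ℂ^(2N)` onto `Ker B`. -/
def projKerB : Module.End ℂ (PhaseSpace N) := ((LinearMap.ker S.B).starProjection).toLinearMap

/-- The compressed operator `P_B^⊥ Ω P_B^⊥` on `ℂ^(2N)`. -/
def compressedOmega : Module.End ℂ (PhaseSpace N) := S.projKerB * S.Omega * S.projKerB

/-- The largest eigenvalue of `Ω` (all eigenvalues of the Hermitian operator `Ω` are real). -/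
def omegaMax : ℝ := sSup {x : ℝ | (x : ℂ) ∈ spectrum ℂ S.Omega}

/-- The smallest nonzero eigenvalue of `B` (all eigenvalues of `B ≥ 0` are real and nonnegative,
and `B ≠ 0`). -/
def bMin : ℝ := sInf {x : ℝ | x ≠ 0 ∧ (x : ℂ) ∈ spectrum ℂ S.B}

/-- The smallest positive eigenvalue of `P_B^⊥ Ω P_B^⊥`; meaningful when this operator is nonzero. -/
def rhoMin : ℝ := sInf {x : ℝ | 0 < x ∧ (x : ℂ) ∈ spectrum ℂ S.compressedOmega}

/-- `c(β) = (2 ω_max² / b_min) (β - 2 ω_max / b_min)⁻¹`, for `β > 2 ω_max / b_min`. -/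
def c (β : ℝ) : ℝ :=
  (2 * S.omegaMax ^ 2 / S.bMin) * (β - 2 * S.omegaMax / S.bMin)⁻¹

/-- The inverse function `c⁻¹(y) = (2 ω_max² / b_min) y⁻¹ + 2 ω_max / b_min`, for `y > 0`. -/
def cInv (y : ℝ) : ℝ :=
  (2 * S.omegaMax ^ 2 / S.bMin) * y⁻¹ + 2 * S.omegaMax / S.bMin

/-- `σ₀(A(β))`: the eigenvalues of `A(β)` in the closed disc of radius `ω_max` about `0`. -/
def spectrumZero (β : ℝ) : Set ℂ :=
  spectrum ℂ (S.A β) ∩ Metric.closedBall 0 S.omegaMax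

/-- `σ₁(A(β))`: the eigenvalues of `A(β)` in the closed discs of radius `ω_max` about the points
`-i β b`, where `b` runs through the nonzero eigenvalues of `B`. -/
def spectrumOne (β : ℝ) : Set ℂ :=
  spectrum ℂ (S.A β) ∩
    ⋃ b ∈ spectrum ℂ S.B \ {0}, Metric.closedBall (-(Complex.I * (β : ℂ) * b)) S.omegaMax

/-- The union of the closed discs `D(ρ; r)` over the nonzero eigenvalues `ρ` of
`P_B^⊥ Ω P_B^⊥`. -/
def rhoDiscs (r : ℝ) : Set ℂ :=
  ⋃ ρ ∈ spectrum ℂ S.compressedOmega \ {0}, Metric.closedBall ρ r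

end LagrangianSystem

/-- `W` is an invariant subspace of `T` and the spectrum of the restriction `T|_W` is the set `s`. -/
def HasRestrictedSpectrum {N : ℕ} (T : Module.End ℂ (PhaseSpace N))
    (W : Submodule ℂ (PhaseSpace N)) (s : Set ℂ) : Prop :=
  ∃ hW : ∀ x ∈ W, T x ∈ W, spectrum ℂ (T.restrict hW) = s

namespace LagrangianSystem

variable {N : ℕ} (S : LagrangianSystem N)

/-- The pair of high-loss and low-loss subspaces: `H = H_hℓ ⊕ H_ℓℓ` with both subspaces
invariant under `A(β)`, `σ(A(β)|H_ℓℓ) = σ₀(A(β))` and `σ(A(β)|H_hℓ) = σ₁(A(β))`. -/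
structure IsLossSplitting (β : ℝ) (Hhl Hll : Submodule ℂ (PhaseSpace N)) : Prop where
  isCompl : IsCompl Hhl Hll
  spectrum_low : HasRestrictedSpectrum (S.A β) Hll (S.spectrumZero β)
  spectrum_high : HasRestrictedSpectrum (S.A β) Hhl (S.spectrumOne β)

/-- The splitting of a low-loss subspace: `H_ℓℓ = H_ℓℓ,0 ⊕ H_ℓℓ,1` with both summands invariant
under `A(β)`, `σ(A(β)|H_ℓℓ,0) = σ(A(β)) ∩ D(0; c(β))` and `σ(A(β)|H_ℓℓ,1)` the part of `σ(A(β))`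
in the union of the discs `D(ρ; c(β))` over the nonzero eigenvalues `ρ` of `P_B^⊥ Ω P_B^⊥`. -/
structure IsLowLossSplitting (β : ℝ) (Hll H0 H1 : Submodule ℂ (PhaseSpace N)) : Prop where
  sup_eq : H0 ⊔ H1 = Hll
  disjoint : Disjoint H0 H1
  spectrum_zero : HasRestrictedSpectrum (S.A β) H0
    (spectrum ℂ (S.A β) ∩ Metric.closedBall 0 (S.c β))
  spectrum_one : HasRestrictedSpectrum (S.A β) H1
    (spectrum ℂ (S.A β) ∩ S.rhoDiscs (S.c β))

end LagrangianSystem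

end

/-!
An eigenvector `v` of `A = Ω - iβB` with eigenvalue `ζ` satisfies `(iβB + ζ) v = Ω v`, so
`‖(iβB + ζ) v‖ ≤ ω_max ‖v‖` and, `B` being Hermitian, `ζ` lies within `ω_max` of some `-iβb` with
`b ∈ σ(B)`. Strong damping separates the disc about `0` from the others, and an invariant subspace
with part of the spectrum of `A` is the sum of the corresponding generalized eigenspaces.

Dimensions are counted without moving `β`, by Lyapunov's inertia argument: if the form of
a Hermitian operator `J` is positive on `V` and negative on `Vᗮ`, and `Re ⟪J x, M x⟫ > 0` for all
`x ≠ 0`, then it is positive on the spectral subspace of `M` for `Re > 0` and negative on that for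
`Re < 0`, so these have the dimensions of `V` and `Vᗮ`. For `M = iA - βb_min/2` and
`J x = P_B x - (2ω_max/(βb_min))² P_Bᗮ x`, where `P_B` projects onto `(Ker B)ᗮ`, this gives the
dimensions of the high-loss and low-loss spaces. It also shows that on the low-loss space
`‖P_B x‖ < (2ω_max/(βb_min)) ‖P_Bᗮ x‖`; hence that space is a graph over `Ker B`, on which `A` acts
as a perturbation of the compression of `Ω` by less than `c(β)`. This locates the low-loss
eigenvalues, and the inertia argument applied to the perturbation at the lines `Re = ±ρ_min/2`
counts those near `0`.

When `Ker R ∩ Ker η = 0`, the compression `C` of `Ω` to `Ker B` satisfies `C⁻¹(Vᗮ) = V` for the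
second summand `V = 0 ⊕ ℂ^N`, and this determines the rank of `C`.
-/

open Module
open scoped InnerProductSpace

section SpectralSubspace

variable {E F : Type*} [AddCommGroup E] [Module ℂ E] [AddCommGroup F] [Module ℂ F]

/-- The spectral subspace of `T` for a set `s` of complex numbers (the range of the Riesz projection
when `s` is isolated from the rest of the spectrum), defined algebraically as the sum of the
generalized eigenspaces of `T` for the eigenvalues in `s`. -/
def spectralSubspace (T : End ℂ E) (s : Set ℂ) : Submodule ℂ E :=
  ⨆ ζ ∈ s, T.maxGenEigenspace ζ

theorem spectralSubspace_union (T : End ℂ E) (s t : Set ℂ) :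
    spectralSubspace T (s ∪ t) = spectralSubspace T s ⊔ spectralSubspace T t :=
  iSup_union

theorem apply_mem_spectralSubspace (T : End ℂ E) (s : Set ℂ) :
    ∀ x ∈ spectralSubspace T s, T x ∈ spectralSubspace T s := by
  suffices spectralSubspace T s ≤ (spectralSubspace T s).comap T from fun _ hx ↦ this hx
  exact iSup₂_le fun ζ hζ _ hy ↦ le_biSup (fun ζ ↦ T.maxGenEigenspace ζ) hζ
    (End.mapsTo_maxGenEigenspace_of_comm (Commute.refl T) ζ hy)

theorem disjoint_spectralSubspace (T : End ℂ E) {s t : Set ℂ} (h : Disjoint s t) :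
    Disjoint (spectralSubspace T s) (spectralSubspace T t) :=
  T.independent_maxGenEigenspace.disjoint_biSup_biSup h

theorem mem_spectralSubspace_of_apply_eq_smul {T : End ℂ E} {s : Set ℂ} {ζ : ℂ} (hζ : ζ ∈ s)
    {v : E} (hv : T v = ζ • v) : v ∈ spectralSubspace T s :=
  le_biSup (fun ζ ↦ T.maxGenEigenspace ζ) hζ
    (End.eigenspace_le_maxGenEigenspace (End.mem_eigenspace_iff.2 hv))

theorem mem_of_apply_eq_smul_of_mem_spectralSubspace {T : End ℂ E} {s : Set ℂ} {ζ : ℂ} {v : E}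
    (hvs : v ∈ spectralSubspace T s) (hv0 : v ≠ 0) (hv : T v = ζ • v) : ζ ∈ s := by
  by_contra h
  exact hv0 <| Submodule.disjoint_def.1
    (disjoint_spectralSubspace T (Set.disjoint_singleton_right.2 h)) v hvs
    (mem_spectralSubspace_of_apply_eq_smul (Set.mem_singleton ζ) hv)

variable [FiniteDimensional ℂ E]

theorem mem_spectrum_iff_exists_apply_eq_smul {T : End ℂ E} {ζ : ℂ} :
    ζ ∈ spectrum ℂ T ↔ ∃ v, v ≠ 0 ∧ T v = ζ • v := by
  rw [← End.hasEigenvalue_iff_mem_spectrum]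
  constructor
  · intro h
    obtain ⟨v, hv⟩ := h.exists_hasEigenvector
    exact ⟨v, hv.2, hv.apply_eq_smul⟩
  · rintro ⟨v, hv0, hv⟩
    exact End.hasEigenvalue_of_hasEigenvector ⟨End.mem_eigenspace_iff.2 hv, hv0⟩

theorem mem_spectrum_restrict_iff {T : End ℂ E} {W : Submodule ℂ E} (hW : ∀ x ∈ W, T x ∈ W)
    {ζ : ℂ} : ζ ∈ spectrum ℂ (T.restrict hW) ↔ ∃ v ∈ W, v ≠ 0 ∧ T v = ζ • v := by
  rw [mem_spectrum_iff_exists_apply_eq_smul]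
  constructor
  · rintro ⟨v, hv0, hv⟩
    exact ⟨v, v.2, by simpa using hv0, by simpa using congrArg Subtype.val hv⟩
  · rintro ⟨v, hvW, hv0, hv⟩
    exact ⟨⟨v, hvW⟩, by simpa using hv0, Subtype.ext hv⟩

theorem spectralSubspace_univ (T : End ℂ E) : spectralSubspace T Set.univ = ⊤ := by
  simpa [spectralSubspace] using T.iSup_maxGenEigenspace_eq_top

theorem finrank_spectralSubspace_union (T : End ℂ E) {s t : Set ℂ} (h : Disjoint s t) :
    finrank ℂ (spectralSubspace T (s ∪ t)) =
      finrank ℂ (spectralSubspace T s) + finrank ℂ (spectralSubspace T t) := by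
  have hdim :=
    Submodule.finrank_sup_add_finrank_inf_eq (spectralSubspace T s) (spectralSubspace T t)
  rw [(disjoint_spectralSubspace T h).eq_bot, ← spectralSubspace_union] at hdim
  simpa using hdim

theorem finrank_spectralSubspace_add_compl (T : End ℂ E) (s : Set ℂ) :
    finrank ℂ (spectralSubspace T s) + finrank ℂ (spectralSubspace T sᶜ) = finrank ℂ E := by
  rw [← finrank_spectralSubspace_union T disjoint_compl_right, Set.union_compl_self,
    spectralSubspace_univ, finrank_top]

theorem le_spectralSubspace {T : End ℂ E} {W : Submodule ℂ E} (hW : ∀ x ∈ W, T x ∈ W) {s : Set ℂ}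
    (h : ∀ ζ, ∀ v ∈ W, v ≠ 0 → T v = ζ • v → ζ ∈ s) : W ≤ spectralSubspace T s := by
  rw [Submodule.eq_iSup_inf_genEigenspace (p := W) (f := T) ⊤ hW T.iSup_maxGenEigenspace_eq_top]
  refine iSup_le fun ζ ↦ ?_
  by_cases hζ : ζ ∈ s
  · exact inf_le_right.trans (le_biSup (fun ζ ↦ T.maxGenEigenspace ζ) hζ)
  suffices W ⊓ T.genEigenspace ζ ⊤ = ⊥ from this.trans_le bot_le
  rw [Submodule.inf_genEigenspace T W hW]
  by_contra hne
  have hunif : End.HasUnifEigenvalue (T.restrict hW) ζ ⊤ := fun hbot ↦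
    hne (by rw [hbot, Submodule.map_bot])
  have hζW := (End.hasUnifEigenvalue_iff_hasUnifEigenvalue_one (by simp)).1 hunif
  obtain ⟨v, hvW, hv0, hv⟩ := (mem_spectrum_restrict_iff hW).1 hζW.mem_spectrum
  exact hζ (h ζ v hvW hv0 hv)

theorem spectralSubspace_le_of_spectrum_inter_subset (T : End ℂ E) {s t : Set ℂ}
    (h : spectrum ℂ T ∩ s ⊆ t) : spectralSubspace T s ≤ spectralSubspace T t :=
  le_spectralSubspace (apply_mem_spectralSubspace T s) fun _ v hv hv0 hTv ↦
    h ⟨mem_spectrum_iff_exists_apply_eq_smul.2 ⟨v, hv0, hTv⟩,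
      mem_of_apply_eq_smul_of_mem_spectralSubspace hv hv0 hTv⟩

theorem spectralSubspace_congr (T : End ℂ E) {s t : Set ℂ}
    (h : ∀ ζ ∈ spectrum ℂ T, ζ ∈ s ↔ ζ ∈ t) : spectralSubspace T s = spectralSubspace T t :=
  (spectralSubspace_le_of_spectrum_inter_subset T fun ζ hζ ↦ (h ζ hζ.1).1 hζ.2).antisymm
    (spectralSubspace_le_of_spectrum_inter_subset T fun ζ hζ ↦ (h ζ hζ.1).2 hζ.2)

theorem spectralSubspace_inter (T : End ℂ E) (s t : Set ℂ) :
    spectralSubspace T (s ∩ t) = spectralSubspace T s ⊓ spectralSubspace T t := by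
  refine le_antisymm (le_inf ?_ ?_) (le_spectralSubspace (fun x hx ↦ ?_) fun ζ v hv hv0 hTv ↦ ?_)
  · exact biSup_mono fun _ hζ ↦ hζ.1
  · exact biSup_mono fun _ hζ ↦ hζ.2
  · exact ⟨apply_mem_spectralSubspace T s x hx.1, apply_mem_spectralSubspace T t x hx.2⟩
  · exact ⟨mem_of_apply_eq_smul_of_mem_spectralSubspace hv.1 hv0 hTv,
      mem_of_apply_eq_smul_of_mem_spectralSubspace hv.2 hv0 hTv⟩

theorem spectralSubspace_smul_add_smul_one (T : End ℂ E) {a : ℂ} (ha : a ≠ 0) (c : ℂ) (s : Set ℂ) :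
    spectralSubspace (a • T + c • 1) s = spectralSubspace T {ζ | a * ζ + c ∈ s} := by
  set T' := a • T + c • 1 with hT'
  have hT'_apply : ∀ x, T' x = a • T x + c • x := fun x ↦ by simp [hT']
  have hT_apply : ∀ x, T x = a⁻¹ • (T' x - c • x) := fun x ↦ by
    rw [hT'_apply, add_sub_cancel_right, inv_smul_smul₀ ha]
  refine le_antisymm (le_spectralSubspace (fun x hx ↦ ?_) fun ζ v hv hv0 hTv ↦ ?_)
    (le_spectralSubspace (fun x hx ↦ ?_) fun ζ v hv hv0 hTv ↦ ?_)
  · rw [hT_apply]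
    exact Submodule.smul_mem _ _
      (Submodule.sub_mem _ (apply_mem_spectralSubspace T' s x hx) (Submodule.smul_mem _ _ hx))
  · have hζ : T' v = (a * ζ + c) • v := by rw [hT'_apply, hTv, smul_smul, ← add_smul]
    rw [Set.mem_ofPred_eq]
    exact mem_of_apply_eq_smul_of_mem_spectralSubspace hv hv0 hζ
  · rw [hT'_apply]
    exact Submodule.add_mem _ (Submodule.smul_mem _ _ (apply_mem_spectralSubspace T _ x hx))
      (Submodule.smul_mem _ _ hx)
  · have hζ : T v = (a⁻¹ * (ζ - c)) • v := by rw [hT_apply, hTv, ← sub_smul, smul_smul]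
    have hmem := mem_of_apply_eq_smul_of_mem_spectralSubspace hv hv0 hζ
    rwa [Set.mem_ofPred_eq, mul_inv_cancel_left₀ ha, sub_add_cancel] at hmem

theorem spectralSubspace_I_smul_add_smul_one_re_pos (T : End ℂ E) (d : ℝ) :
    spectralSubspace (Complex.I • T + (-d : ℂ) • 1) {ζ | 0 < ζ.re} =
      spectralSubspace T {ζ | d < -ζ.im} := by
  rw [spectralSubspace_smul_add_smul_one T Complex.I_ne_zero]
  congr 1
  ext ζ
  simp [← sub_eq_add_neg]

theorem spectralSubspace_I_smul_add_smul_one_re_neg (T : End ℂ E) (d : ℝ) :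
    spectralSubspace (Complex.I • T + (-d : ℂ) • 1) {ζ | ζ.re < 0} =
      spectralSubspace T {ζ | -ζ.im < d} := by
  rw [spectralSubspace_smul_add_smul_one T Complex.I_ne_zero]
  congr 1
  ext ζ
  simp [← sub_eq_add_neg]

theorem comap_spectralSubspace [FiniteDimensional ℂ F] {g : F →ₗ[ℂ] E}
    (hg : Function.Injective g) {T : End ℂ E} {T' : End ℂ F} (hgT : ∀ x, g (T' x) = T (g x))
    (s : Set ℂ) : (spectralSubspace T s).comap g = spectralSubspace T' s := by
  have hTg : ∀ {ζ x}, T' x = ζ • x → T (g x) = ζ • g x := fun hx ↦ by rw [← hgT, hx, map_smul]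
  refine le_antisymm (le_spectralSubspace (fun x hx ↦ ?_) fun ζ v hv hv0 hTv ↦ ?_)
    (Submodule.map_le_iff_le_comap.1 (le_spectralSubspace ?_ ?_))
  · exact Submodule.mem_comap.2 (hgT x ▸ apply_mem_spectralSubspace T s _ hx)
  · exact mem_of_apply_eq_smul_of_mem_spectralSubspace hv ((map_ne_zero_iff g hg).2 hv0) (hTg hTv)
  · rintro _ ⟨x, hx, rfl⟩
    exact hgT x ▸ Submodule.mem_map_of_mem (apply_mem_spectralSubspace T' s x hx)
  · rintro ζ _ ⟨v, hv, rfl⟩ hv0 hTv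
    refine mem_of_apply_eq_smul_of_mem_spectralSubspace hv (fun h ↦ hv0 (by rw [h, map_zero]))
      (hg ?_)
    rw [hgT, hTv, map_smul]

end SpectralSubspace

section Restricted

variable {N : ℕ} {T : End ℂ (PhaseSpace N)}

theorem hasRestrictedSpectrum_spectralSubspace {s : Set ℂ} (hs : s ⊆ spectrum ℂ T) :
    HasRestrictedSpectrum T (spectralSubspace T s) s := by
  refine ⟨apply_mem_spectralSubspace T s, ?_⟩
  ext ζ
  rw [mem_spectrum_restrict_iff]
  constructor
  · rintro ⟨v, hv, hv0, hTv⟩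
    exact mem_of_apply_eq_smul_of_mem_spectralSubspace hv hv0 hTv
  · intro hζ
    obtain ⟨v, hv0, hTv⟩ := mem_spectrum_iff_exists_apply_eq_smul.1 (hs hζ)
    exact ⟨v, mem_spectralSubspace_of_apply_eq_smul hζ hTv, hv0, hTv⟩

theorem HasRestrictedSpectrum.le_spectralSubspace {W : Submodule ℂ (PhaseSpace N)} {s : Set ℂ}
    (h : HasRestrictedSpectrum T W s) : W ≤ spectralSubspace T s := by
  obtain ⟨hW, rfl⟩ := h
  exact _root_.le_spectralSubspace hW fun ζ v hv hv0 hTv ↦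
    (mem_spectrum_restrict_iff hW).2 ⟨v, hv, hv0, hTv⟩

theorem HasRestrictedSpectrum.eq_spectralSubspace {W W' : Submodule ℂ (PhaseSpace N)}
    {s t : Set ℂ} (hst : Disjoint s t) (hW : HasRestrictedSpectrum T W s)
    (hW' : HasRestrictedSpectrum T W' t) (hsup : spectralSubspace T (s ∪ t) ≤ W ⊔ W') :
    W = spectralSubspace T s := by
  refine eq_of_le_of_inf_le_of_le_sup (z := W') hW.le_spectralSubspace ?_ ?_
  · exact ((disjoint_spectralSubspace T hst).mono_right hW'.le_spectralSubspace).le_bot.trans bot_le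
  · rw [spectralSubspace_union] at hsup
    exact le_sup_left.trans hsup

end Restricted

section Symmetric

variable {E : Type*} [NormedAddCommGroup E] [InnerProductSpace ℂ E]
  {T : End ℂ E}

theorem spectralSubspace_singleton (hT : T.IsSymmetric) (ζ : ℂ) :
    spectralSubspace T {ζ} = T.eigenspace ζ := by
  rw [spectralSubspace, iSup_singleton]
  exact hT.isFinitelySemisimple.maxGenEigenspace_eq_eigenspace ζ

theorem inner_eq_zero_of_mem_spectralSubspace (hT : T.IsSymmetric) {s : Set ℂ} {ζ : ℂ} (hζ : ζ ∉ s)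
    {v x : E} (hv : T v = ζ • v) (hx : x ∈ spectralSubspace T s) : ⟪v, x⟫_ℂ = 0 := by
  suffices spectralSubspace T s ≤ (ℂ ∙ v)ᗮ from Submodule.mem_orthogonal_singleton_iff_inner_right.1
    (this hx)
  refine iSup₂_le fun μ hμ y hy ↦ Submodule.mem_orthogonal_singleton_iff_inner_right.2 ?_
  rw [hT.isFinitelySemisimple.maxGenEigenspace_eq_eigenspace μ] at hy
  exact hT.orthogonalFamily_eigenspaces (ne_of_mem_of_not_mem hμ hζ).symm
    ⟨v, End.mem_eigenspace_iff.2 hv⟩ ⟨y, hy⟩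

variable [FiniteDimensional ℂ E]

theorem ofReal_eigenvalues_mem_spectrum (hT : T.IsSymmetric) (i : Fin (finrank ℂ E)) :
    (hT.eigenvalues rfl i : ℂ) ∈ spectrum ℂ T :=
  (hT.hasEigenvalue_eigenvalues rfl i).mem_spectrum

theorem im_eq_zero_of_mem_spectrum (hT : T.IsSymmetric) {ζ : ℂ} (hζ : ζ ∈ spectrum ℂ T) :
    ζ.im = 0 :=
  Complex.conj_eq_iff_im.1 (hT.conj_eigenvalue_eq_self (End.hasEigenvalue_iff_mem_spectrum.2 hζ))

theorem ofReal_re_of_mem_spectrum (hT : T.IsSymmetric) {ζ : ℂ} (hζ : ζ ∈ spectrum ℂ T) :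
    (ζ.re : ℂ) = ζ :=
  Complex.ext rfl (im_eq_zero_of_mem_spectrum hT hζ).symm

theorem inner_eigenvectorBasis_apply (hT : T.IsSymmetric) (i : Fin (finrank ℂ E)) (x : E) :
    ⟪hT.eigenvectorBasis rfl i, T x⟫_ℂ =
      hT.eigenvalues rfl i * ⟪hT.eigenvectorBasis rfl i, x⟫_ℂ := by
  rw [← hT, hT.apply_eigenvectorBasis, inner_smul_left]
  simp

theorem norm_sq_smul_apply_add_smul (hT : T.IsSymmetric) (a z : ℂ) (x : E) :
    ‖a • T x + z • x‖ ^ 2 = ∑ i, ‖a * hT.eigenvalues rfl i + z‖ ^ 2 *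
      ‖⟪hT.eigenvectorBasis rfl i, x⟫_ℂ‖ ^ 2 := by
  rw [← (hT.eigenvectorBasis rfl).sum_sq_norm_inner_right]
  refine Finset.sum_congr rfl fun i _ ↦ ?_
  rw [inner_add_right, inner_smul_right, inner_smul_right, inner_eigenvectorBasis_apply hT,
    ← mul_assoc, ← add_mul, norm_mul, mul_pow]

theorem exists_mem_spectrum_norm_le_of_isSymmetric (hT : T.IsSymmetric) {a z : ℂ} {m : ℝ} {x : E}
    (hx : x ≠ 0) (h : ‖a • T x + z • x‖ ≤ m * ‖x‖) :
    ∃ μ : ℝ, (μ : ℂ) ∈ spectrum ℂ T ∧ ‖a * μ + z‖ ≤ m := by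
  by_contra! hcon
  have hm : 0 ≤ m := nonneg_of_mul_nonneg_left ((norm_nonneg _).trans h) (norm_pos_iff.2 hx)
  have hlt : ∀ i, m ^ 2 < ‖a * hT.eigenvalues rfl i + z‖ ^ 2 := fun i ↦
    pow_lt_pow_left₀ (hcon _ (ofReal_eigenvalues_mem_spectrum hT i)) hm two_ne_zero
  obtain ⟨i, hi⟩ : ∃ i, ⟪hT.eigenvectorBasis rfl i, x⟫_ℂ ≠ 0 := by
    by_contra! h0
    have hsum := (hT.eigenvectorBasis rfl).sum_sq_norm_inner_right x
    exact hx (by simpa [h0, eq_comm] using hsum)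
  refine (pow_le_pow_left₀ (norm_nonneg _) h 2).not_gt ?_
  rw [norm_sq_smul_apply_add_smul hT, mul_pow,
    ← (hT.eigenvectorBasis rfl).sum_sq_norm_inner_right, Finset.mul_sum]
  exact Finset.sum_lt_sum (fun j _ ↦ mul_le_mul_of_nonneg_right (hlt j).le (sq_nonneg _))
    ⟨i, Finset.mem_univ _, mul_lt_mul_of_pos_right (hlt i) (by positivity)⟩

theorem norm_apply_le_of_forall_mem_spectrum (hT : T.IsSymmetric) {M : ℝ} (hM : 0 ≤ M)
    (h : ∀ μ : ℝ, (μ : ℂ) ∈ spectrum ℂ T → |μ| ≤ M) (x : E) : ‖T x‖ ≤ M * ‖x‖ := by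
  refine le_of_sq_le_sq ?_ (by positivity)
  have hTx := norm_sq_smul_apply_add_smul hT 1 0 x
  rw [one_smul, zero_smul, add_zero] at hTx
  rw [hTx, mul_pow, ← (hT.eigenvectorBasis rfl).sum_sq_norm_inner_right, Finset.mul_sum]
  gcongr with i
  simpa using h _ (ofReal_eigenvalues_mem_spectrum hT i)

theorem mul_norm_sq_le_re_inner_apply (hT : T.IsSymmetric) {m : ℝ} {x : E}
    (h : ∀ (μ : ℝ) (v : E), T v = (μ : ℂ) • v → ⟪v, x⟫_ℂ ≠ 0 → m ≤ μ) :
    m * ‖x‖ ^ 2 ≤ (⟪x, T x⟫_ℂ).re := by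
  have hinner : ∀ i, (⟪x, hT.eigenvectorBasis rfl i⟫_ℂ * ⟪hT.eigenvectorBasis rfl i, T x⟫_ℂ).re =
      hT.eigenvalues rfl i * ‖⟪hT.eigenvectorBasis rfl i, x⟫_ℂ‖ ^ 2 := fun i ↦ by
    rw [inner_eigenvectorBasis_apply hT, mul_left_comm, ← inner_conj_symm,
      ← Complex.normSq_eq_conj_mul_self, Complex.normSq_eq_norm_sq, ← Complex.ofReal_mul,
      Complex.ofReal_re]
  rw [← (hT.eigenvectorBasis rfl).sum_inner_mul_inner, Complex.re_sum,
    ← (hT.eigenvectorBasis rfl).sum_sq_norm_inner_right, Finset.mul_sum]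
  refine Finset.sum_le_sum fun i _ ↦ ?_
  rw [hinner]
  by_cases hi : ⟪hT.eigenvectorBasis rfl i, x⟫_ℂ = 0
  · simp [hi]
  · gcongr
    exact h _ _ (hT.apply_eigenvectorBasis rfl i) hi

theorem re_inner_apply_le_mul_norm_sq (hT : T.IsSymmetric) {m : ℝ} {x : E}
    (h : ∀ (μ : ℝ) (v : E), T v = (μ : ℂ) • v → ⟪v, x⟫_ℂ ≠ 0 → μ ≤ m) :
    (⟪x, T x⟫_ℂ).re ≤ m * ‖x‖ ^ 2 := by
  have hneg := mul_norm_sq_le_re_inner_apply (T := -T) (m := -m) (x := x)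
    (fun y z ↦ by simp [hT y z]) fun μ v hv hvx ↦ by
      have := h (-μ) v (by rw [Complex.ofReal_neg, neg_smul, ← hv]; simp) hvx
      linarith
  rw [LinearMap.neg_apply, inner_neg_right, Complex.neg_re] at hneg
  linarith

end Symmetric

section Compression

variable {E : Type*} [NormedAddCommGroup E] [InnerProductSpace ℂ E]

/-- The compression of `T` to the subspace `K`, as an operator on `K` itself. The operator
`P_K T P_K` acts on the whole space and vanishes on `Kᗮ`; passing to `K` removes this trivial
part of its kernel. -/
noncomputable def compression (K : Submodule ℂ E) [K.HasOrthogonalProjection] (T : End ℂ E) :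
    End ℂ K :=
  K.orthogonalProjectionOnto.toLinearMap ∘ₗ T ∘ₗ K.subtype

variable {K : Submodule ℂ E} [K.HasOrthogonalProjection] {T : End ℂ E}

theorem inner_compression_left (x y : K) : ⟪compression K T x, y⟫_ℂ = ⟪T x, (y : E)⟫_ℂ :=
  K.inner_orthogonalProjectionOnto_eq_of_mem_right y (T x)

theorem inner_compression_right (x y : K) : ⟪x, compression K T y⟫_ℂ = ⟪(x : E), T y⟫_ℂ :=
  K.inner_orthogonalProjectionOnto_eq_of_mem_left x (T y)

theorem isSymmetric_compression (hT : T.IsSymmetric) : (compression K T).IsSymmetric := fun x y ↦ by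
  rw [inner_compression_left, inner_compression_right, hT]

end Compression

section Inertia

theorem exists_lt_forall_apply_sub_smul_mem {E : Type*} [AddCommGroup E] [Module ℂ E]
    [FiniteDimensional ℂ E] {T : End ℂ E} {W : Submodule ℂ E} (hW : ∀ x ∈ W, T x ∈ W) {ζ : ℂ}
    {v : E} (hv : v ∈ W) (hv0 : v ≠ 0) (hTv : T v = ζ • v) :
    ∃ W' < W, (∀ x ∈ W', T x ∈ W') ∧ ∀ x ∈ W, T x - ζ • x ∈ W' := by
  have hTζ : ∀ x, (T - ζ • 1) x = T x - ζ • x := fun x ↦ by simp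
  have hWζ : ∀ x ∈ W, (T - ζ • 1) x ∈ W := fun x hx ↦
    hTζ x ▸ W.sub_mem (hW x hx) (W.smul_mem ζ hx)
  refine ⟨W.map (T - ζ • 1), lt_of_le_of_ne (Submodule.map_le_iff_le_comap.2 hWζ) fun h ↦ ?_, ?_,
    fun x hx ↦ hTζ x ▸ Submodule.mem_map_of_mem hx⟩
  · have hsurj : Function.Surjective ((T - ζ • 1).restrict hWζ) := fun y ↦ by
      obtain ⟨x, hx, hxy⟩ := Submodule.mem_map.1 (h.ge y.2)
      exact ⟨⟨x, hx⟩, Subtype.ext hxy⟩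
    have hker : (T - ζ • 1).restrict hWζ ⟨v, hv⟩ = 0 :=
      Subtype.ext (by simp [hTv])
    have hv' := (injective_iff_map_eq_zero _).1 (LinearMap.injective_iff_surjective.2 hsurj) _ hker
    exact hv0 (congrArg Subtype.val hv')
  · rintro _ ⟨x, hx, rfl⟩
    exact ⟨T x, hW x hx, by simp⟩

variable {E : Type*} [NormedAddCommGroup E] [InnerProductSpace ℂ E]

theorem re_inner_apply_pos_of_inner_apply_sub_smul_eq_zero {J T : End ℂ E} (hJ : J.IsSymmetric)
    {ζ : ℂ} (hζ : 0 < ζ.re) {v : E} (horth : ⟪J v, T v - ζ • v⟫_ℂ = 0)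
    (hpos : 0 < (⟪J v, T v⟫_ℂ).re) : 0 < (⟪J v, v⟫_ℂ).re := by
  have him : (⟪J v, v⟫_ℂ).im = 0 := hJ.im_inner_apply_self v
  rw [inner_sub_right, sub_eq_zero, inner_smul_right] at horth
  rw [horth, Complex.mul_re, him, mul_zero, sub_zero] at hpos
  exact pos_of_mul_pos_right hpos hζ.le

variable [FiniteDimensional ℂ E]

theorem exists_mem_forall_inner_apply_sub_eq_zero {J : End ℂ E} (hJ : J.IsSymmetric)
    {W : Submodule ℂ E} (hpos : ∀ y ∈ W, y ≠ 0 → 0 < (⟪J y, y⟫_ℂ).re) (x : E) :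
    ∃ w ∈ W, ∀ y ∈ W, ⟪J y, x - w⟫_ℂ = 0 := by
  have hinj : Function.Injective (compression W J) := by
    refine (injective_iff_map_eq_zero _).2 fun y hy ↦ ?_
    by_contra hy0
    refine (hpos y y.2 (by simpa using hy0)).ne' ?_
    rw [← inner_compression_left, hy, inner_zero_left, Complex.zero_re]
  obtain ⟨w, hw⟩ := LinearMap.injective_iff_surjective.1 hinj (W.orthogonalProjectionOnto (J x))
  refine ⟨w, w.2, fun y hy ↦ ?_⟩
  rw [inner_sub_right, hJ, hJ, ← inner_compression_right ⟨y, hy⟩ w, hw,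
    W.inner_orthogonalProjectionOnto_eq_of_mem_left, sub_self]

theorem re_inner_apply_self_pos_of_lyapunov {J : End ℂ E} (hJ : J.IsSymmetric) (T : End ℂ E)
    (W : Submodule ℂ E) (hW : ∀ x ∈ W, T x ∈ W)
    (hpos : ∀ x ∈ W, x ≠ 0 → 0 < (⟪J x, T x⟫_ℂ).re)
    (hspec : ∀ ζ : ℂ, ∀ v ∈ W, v ≠ 0 → T v = ζ • v → 0 < ζ.re) :
    ∀ x ∈ W, x ≠ 0 → 0 < (⟪J x, x⟫_ℂ).re := by
  induction W using WellFoundedLT.induction with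
  | _ W ih =>
  intro x hx hx0
  have : Nontrivial W := ⟨⟨⟨x, hx⟩, 0, by simpa using hx0⟩⟩
  obtain ⟨ζ, hζ⟩ := End.exists_eigenvalue (T.restrict hW)
  obtain ⟨u, huW, hu0, hTu⟩ := (mem_spectrum_restrict_iff hW).1 hζ.mem_spectrum
  obtain ⟨W', hlt, hW', hsub⟩ := exists_lt_forall_apply_sub_smul_mem hW huW hu0 hTu
  have hpos' := ih W' hlt hW' (fun y hy ↦ hpos y (hlt.le hy)) fun μ v hv ↦ hspec μ v (hlt.le hv)
  obtain ⟨w, hw, horth⟩ := exists_mem_forall_inner_apply_sub_eq_zero hJ hpos' x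
  obtain ⟨v, rfl⟩ : ∃ v, x = w + v := ⟨x - w, by abel⟩
  rw [add_sub_cancel_left] at horth
  have horth' : ∀ y ∈ W', ⟪J v, y⟫_ℂ = 0 := fun y hy ↦ by
    rw [hJ, ← inner_conj_symm, horth y hy, map_zero]
  have hvW : v ∈ W := (W.add_mem_iff_right (hlt.le hw)).1 hx
  have hform : (⟪J (w + v), w + v⟫_ℂ).re = (⟪J w, w⟫_ℂ).re + (⟪J v, v⟫_ℂ).re := by
    rw [map_add, inner_add_left, inner_add_right, inner_add_right, horth w hw, horth' w hw,
      add_zero, zero_add, Complex.add_re]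
  have hv : v ≠ 0 → 0 < (⟪J v, v⟫_ℂ).re := fun hv0 ↦
    re_inner_apply_pos_of_inner_apply_sub_smul_eq_zero hJ (hspec ζ u huW hu0 hTu)
      (horth' _ (hsub v hvW)) (hpos v hvW hv0)
  rw [hform]
  rcases eq_or_ne v 0 with rfl | hv0
  · simpa using hpos' w hw (by simpa using hx0)
  rcases eq_or_ne w 0 with rfl | hw0
  · simpa using hv hv0
  · exact add_pos (hpos' w hw hw0) (hv hv0)

/-- The Hermitian form `‖P_V x‖² - t ‖P_{Vᗮ} x‖²`, given by its symmetric operator; for `t > 0` its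
positive index is the dimension of `V` and its negative index that of `Vᗮ`. -/
noncomputable def indefiniteForm (V : Submodule ℂ E) (t : ℝ) : End ℂ E :=
  V.starProjection.toLinearMap - (t : ℂ) • Vᗮ.starProjection.toLinearMap

variable {V : Submodule ℂ E} {t : ℝ}

theorem indefiniteForm_apply (x : E) :
    indefiniteForm V t x = V.starProjection x - (t : ℂ) • Vᗮ.starProjection x :=
  rfl

theorem indefiniteForm_apply_add {y z : E} (hy : y ∈ V) (hz : z ∈ Vᗮ) :
    indefiniteForm V t (y + z) = y - (t : ℂ) • z := by
  rw [indefiniteForm_apply, V.starProjection_orthogonal_val, map_add,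
    Submodule.starProjection_eq_self_iff.2 hy, (Submodule.starProjection_apply_eq_zero_iff V).2 hz,
    add_zero, add_sub_cancel_left]

theorem isSymmetric_indefiniteForm : (indefiniteForm V t).IsSymmetric := fun x y ↦ by
  simp only [indefiniteForm_apply, inner_sub_left, inner_sub_right, inner_smul_left,
    inner_smul_right, Submodule.inner_starProjection_left_eq_right, Complex.conj_ofReal]

theorem re_inner_indefiniteForm_self (x : E) :
    (⟪indefiniteForm V t x, x⟫_ℂ).re =
      ‖V.starProjection x‖ ^ 2 - t * ‖Vᗮ.starProjection x‖ ^ 2 := by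
  have hV := V.re_inner_starProjection_eq_normSq x
  have hV' := Vᗮ.re_inner_starProjection_eq_normSq x
  rw [RCLike.re_eq_complex_re] at hV hV'
  rw [indefiniteForm_apply, inner_sub_left, inner_smul_left, Complex.conj_ofReal, Complex.sub_re,
    Complex.re_ofReal_mul, hV, hV']
  rfl

theorem finrank_le_of_disjoint_orthogonal {W : Submodule ℂ E} (h : Disjoint W Vᗮ) :
    finrank ℂ W ≤ finrank ℂ V := by
  have hle := Submodule.finrank_add_finrank_le_of_disjoint h
  have hV := V.finrank_add_finrank_orthogonal
  omega

section

variable {T : End ℂ E} (hpos : ∀ x, x ≠ 0 → 0 < (⟪indefiniteForm V t x, T x⟫_ℂ).re)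
include hpos

theorem re_ne_zero_of_mem_spectrum_of_re_inner_pos {ζ : ℂ} (hζ : ζ ∈ spectrum ℂ T) :
    ζ.re ≠ 0 := by
  obtain ⟨v, hv0, hTv⟩ := mem_spectrum_iff_exists_apply_eq_smul.1 hζ
  intro hre
  refine (hpos v hv0).ne' ?_
  have him : (⟪indefiniteForm V t v, v⟫_ℂ).im = 0 :=
    isSymmetric_indefiniteForm.im_inner_apply_self v
  rw [hTv, inner_smul_right, Complex.mul_re, hre, him, zero_mul, mul_zero, sub_zero]

theorem re_inner_pos_of_mem_spectralSubspace_re_pos {x : E}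
    (hx : x ∈ spectralSubspace T {ζ | 0 < ζ.re}) (hx0 : x ≠ 0) :
    0 < (⟪indefiniteForm V t x, x⟫_ℂ).re :=
  re_inner_apply_self_pos_of_lyapunov isSymmetric_indefiniteForm T _
    (apply_mem_spectralSubspace T _) (fun y _ ↦ hpos y)
    (fun _ _ hv hv0 hTv ↦ mem_of_apply_eq_smul_of_mem_spectralSubspace hv hv0 hTv) x hx hx0

theorem re_inner_neg_of_mem_spectralSubspace_re_neg {x : E}
    (hx : x ∈ spectralSubspace T {ζ | ζ.re < 0}) (hx0 : x ≠ 0) :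
    (⟪indefiniteForm V t x, x⟫_ℂ).re < 0 := by
  have hneg : ∀ {v : E} {ζ : ℂ}, (-T) v = ζ • v → T v = (-ζ) • v := fun h ↦ by
    rw [neg_smul, ← h, LinearMap.neg_apply, neg_neg]
  have hform := re_inner_apply_self_pos_of_lyapunov (J := -indefiniteForm V t)
    (fun y z ↦ by simp [isSymmetric_indefiniteForm y z]) (-T) _
    (fun y hy ↦ Submodule.neg_mem _ (apply_mem_spectralSubspace T _ y hy))
    (fun y _ hy0 ↦ by simpa using hpos y hy0)
    (fun ζ v hv hv0 hTv ↦ by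
      simpa using mem_of_apply_eq_smul_of_mem_spectralSubspace hv hv0 (hneg hTv)) x hx hx0
  simpa using hform

theorem finrank_spectralSubspace_re_pos_add_re_neg :
    finrank ℂ (spectralSubspace T {ζ | 0 < ζ.re}) +
      finrank ℂ (spectralSubspace T {ζ | ζ.re < 0}) = finrank ℂ E := by
  rw [← finrank_spectralSubspace_add_compl T {ζ | 0 < ζ.re},
    spectralSubspace_congr T (s := {ζ | 0 < ζ.re}ᶜ) (t := {ζ | ζ.re < 0}) fun ζ hζ ↦ ?_]
  have hre := re_ne_zero_of_mem_spectrum_of_re_inner_pos hpos hζ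
  exact not_lt.trans ⟨fun h ↦ lt_of_le_of_ne h hre, le_of_lt⟩

theorem finrank_spectralSubspace_re_pos_and_re_neg (ht : 0 ≤ t) :
    finrank ℂ (spectralSubspace T {ζ | 0 < ζ.re}) = finrank ℂ V ∧
      finrank ℂ (spectralSubspace T {ζ | ζ.re < 0}) = finrank ℂ Vᗮ := by
  have hle : finrank ℂ (spectralSubspace T {ζ | 0 < ζ.re}) ≤ finrank ℂ V := by
    refine finrank_le_of_disjoint_orthogonal (Submodule.disjoint_def.2 fun x hx hxV ↦ ?_)
    by_contra hx0
    have hform := re_inner_pos_of_mem_spectralSubspace_re_pos hpos hx hx0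
    rw [re_inner_indefiniteForm_self, (Submodule.starProjection_apply_eq_zero_iff V).2 hxV,
      norm_zero] at hform
    nlinarith [mul_nonneg ht (sq_nonneg ‖Vᗮ.starProjection x‖)]
  have hle' : finrank ℂ (spectralSubspace T {ζ | ζ.re < 0}) ≤ finrank ℂ Vᗮ := by
    refine finrank_le_of_disjoint_orthogonal (Submodule.disjoint_def.2 fun x hx hxV ↦ ?_)
    by_contra hx0
    have hform := re_inner_neg_of_mem_spectralSubspace_re_neg hpos hx hx0
    rw [re_inner_indefiniteForm_self, (Submodule.starProjection_apply_eq_zero_iff Vᗮ).2 hxV,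
      norm_zero] at hform
    nlinarith [sq_nonneg ‖V.starProjection x‖]
  have hsum := finrank_spectralSubspace_re_pos_add_re_neg hpos
  have hV := V.finrank_add_finrank_orthogonal
  omega

end

end Inertia

section Perturbation

variable {E : Type*} [NormedAddCommGroup E] [InnerProductSpace ℂ E] [FiniteDimensional ℂ E]
  {C T : End ℂ E}

theorem indefiniteForm_one_apply (V : Submodule ℂ E) (x : E) :
    indefiniteForm V 1 x = V.reflection x := by
  rw [indefiniteForm_apply, Complex.ofReal_one, one_smul, V.starProjection_orthogonal_val,
    V.reflection_apply, two_smul]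
  abel

theorem norm_indefiniteForm_one_apply (V : Submodule ℂ E) (x : E) :
    ‖indefiniteForm V 1 x‖ = ‖x‖ := by
  rw [indefiniteForm_one_apply, V.reflection.norm_map]

theorem mul_norm_sq_le_re_inner_apply_of_mem_spectralSubspace (hC : C.IsSymmetric) {s : Set ℂ}
    {m : ℝ} (hs : ∀ μ : ℝ, (μ : ℂ) ∈ spectrum ℂ C → (μ : ℂ) ∈ s → m ≤ μ) {x : E}
    (hx : x ∈ spectralSubspace C s) : m * ‖x‖ ^ 2 ≤ (⟪x, C x⟫_ℂ).re := by
  refine mul_norm_sq_le_re_inner_apply hC fun μ v hv hvx ↦ hs μ ?_ ?_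
  · exact mem_spectrum_iff_exists_apply_eq_smul.2
      ⟨v, fun h ↦ hvx (by rw [h, inner_zero_left]), hv⟩
  · by_contra hμ
    exact hvx (inner_eq_zero_of_mem_spectralSubspace hC hμ hv hx)

theorem re_inner_apply_le_mul_norm_sq_of_mem_orthogonal_spectralSubspace (hC : C.IsSymmetric)
    {s : Set ℂ} {m : ℝ} (hs : ∀ μ : ℝ, (μ : ℂ) ∈ spectrum ℂ C → (μ : ℂ) ∉ s → μ ≤ m) {x : E}
    (hx : x ∈ (spectralSubspace C s)ᗮ) : (⟪x, C x⟫_ℂ).re ≤ m * ‖x‖ ^ 2 := by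
  refine re_inner_apply_le_mul_norm_sq hC fun μ v hv hvx ↦ hs μ ?_ fun hμ ↦ hvx ?_
  · exact mem_spectrum_iff_exists_apply_eq_smul.2
      ⟨v, fun h ↦ hvx (by rw [h, inner_zero_left]), hv⟩
  · exact hx v (mem_spectralSubspace_of_apply_eq_smul hμ hv)

theorem mul_norm_sq_le_re_inner_indefiniteForm_of_gap (hC : C.IsSymmetric) {a r : ℝ}
    (hgap : ∀ μ : ℝ, (μ : ℂ) ∈ spectrum ℂ C → r ≤ |μ - a|) (x : E) :
    r * ‖x‖ ^ 2 ≤ (⟪indefiniteForm (spectralSubspace C {ζ | a < ζ.re}) 1 x,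
      C x - (a : ℂ) • x⟫_ℂ).re := by
  set V := spectralSubspace C {ζ | a < ζ.re}
  obtain ⟨y, hy, z, hz, rfl⟩ := V.exists_add_mem_mem_orthogonal x
  have hself : ∀ u : E, (⟪u, C u - (a : ℂ) • u⟫_ℂ).re = (⟪u, C u⟫_ℂ).re - a * ‖u‖ ^ 2 := fun u ↦ by
    rw [inner_sub_right, inner_smul_right, Complex.sub_re, Complex.re_ofReal_mul,
      ← RCLike.re_eq_complex_re, inner_self_eq_norm_sq]
  have hCy : (a + r) * ‖y‖ ^ 2 ≤ (⟪y, C y⟫_ℂ).re := by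
    refine mul_norm_sq_le_re_inner_apply_of_mem_spectralSubspace hC (fun μ hμ hμa ↦ ?_) hy
    linarith [hgap μ hμ, abs_of_pos (sub_pos.2 (show a < μ from hμa))]
  have hCz : (⟪z, C z⟫_ℂ).re ≤ (a - r) * ‖z‖ ^ 2 := by
    refine re_inner_apply_le_mul_norm_sq_of_mem_orthogonal_spectralSubspace hC
      (fun μ hμ hμa ↦ ?_) hz
    linarith [hgap μ hμ, abs_of_nonpos (sub_nonpos.2 (not_lt.1 (show ¬ a < μ from hμa)))]
  have hCyV : C y - (a : ℂ) • y ∈ V :=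
    V.sub_mem (apply_mem_spectralSubspace C _ y hy) (V.smul_mem _ hy)
  have hyCz : ⟪y, C z - (a : ℂ) • z⟫_ℂ = 0 := by
    rw [inner_sub_right, ← hC, inner_smul_right, hz _ (apply_mem_spectralSubspace C _ y hy),
      hz y hy, mul_zero, sub_zero]
  have hform : (⟪indefiniteForm V 1 (y + z), C (y + z) - (a : ℂ) • (y + z)⟫_ℂ).re =
      (⟪y, C y - (a : ℂ) • y⟫_ℂ).re - (⟪z, C z - (a : ℂ) • z⟫_ℂ).re := by
    rw [indefiniteForm_apply_add hy hz, Complex.ofReal_one, one_smul, map_add, smul_add,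
      add_sub_add_comm, inner_sub_left, inner_add_right, inner_add_right, hyCz,
      inner_eq_zero_symm.1 (hz _ hCyV), add_zero, zero_add, Complex.sub_re]
  rw [hform, hself, hself, sq, norm_add_sq_eq_norm_sq_add_norm_sq_of_inner_eq_zero y z (hz y hy)]
  linarith

theorem finrank_spectralSubspace_re_gt_eq_of_gap (hC : C.IsSymmetric) {a r : ℝ}
    (hgap : ∀ μ : ℝ, (μ : ℂ) ∈ spectrum ℂ C → r ≤ |μ - a|)
    (hT : ∀ x, x ≠ 0 → ‖T x - C x‖ < r * ‖x‖) :
    finrank ℂ (spectralSubspace T {ζ | a < ζ.re}) =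
      finrank ℂ (spectralSubspace C {ζ | a < ζ.re}) := by
  set V := spectralSubspace C {ζ | a < ζ.re}
  have hpos : ∀ x, x ≠ 0 →
      0 < (⟪indefiniteForm V 1 x, ((1 : ℂ) • T + (-a : ℂ) • 1) x⟫_ℂ).re := fun x hx ↦ by
    have hCx := mul_norm_sq_le_re_inner_indefiniteForm_of_gap hC hgap x
    have hdiff := (abs_le.1 (Complex.abs_re_le_norm
      ⟪indefiniteForm V 1 x, T x - C x⟫_ℂ)).1
    have hnorm := norm_inner_le_norm (𝕜 := ℂ) (indefiniteForm V 1 x) (T x - C x)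
    rw [norm_indefiniteForm_one_apply] at hnorm
    have hsplit : ((1 : ℂ) • T + (-a : ℂ) • 1) x = (T x - C x) + (C x - (a : ℂ) • x) := by
      simp [sub_eq_add_neg]
    rw [hsplit, inner_add_right, Complex.add_re]
    have := mul_lt_mul_of_pos_left (hT x hx) (norm_pos_iff.2 hx)
    nlinarith
  rw [← (finrank_spectralSubspace_re_pos_and_re_neg hpos zero_le_one).1,
    spectralSubspace_smul_add_smul_one T one_ne_zero]
  refine congrArg (fun s ↦ finrank ℂ (spectralSubspace T s)) (Set.ext fun ζ ↦ ?_)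
  simp only [Set.mem_ofPred_eq, Complex.add_re, Complex.neg_re, Complex.ofReal_re, one_mul,
    lt_add_neg_iff_add_lt, zero_add]

theorem finrank_spectralSubspace_strip_eq_finrank_ker (hC : C.IsSymmetric) {r : ℝ} (hr : 0 < r)
    (hgap : ∀ μ : ℝ, (μ : ℂ) ∈ spectrum ℂ C → μ ≠ 0 → 2 * r ≤ |μ|)
    (hT : ∀ x, x ≠ 0 → ‖T x - C x‖ < r * ‖x‖) :
    finrank ℂ (spectralSubspace T {ζ | -r < ζ.re ∧ ζ.re ≤ r}) = finrank ℂ (LinearMap.ker C) := by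
  have hsplit : ∀ S : End ℂ E, finrank ℂ (spectralSubspace S {ζ | -r < ζ.re}) =
      finrank ℂ (spectralSubspace S {ζ | -r < ζ.re ∧ ζ.re ≤ r}) +
        finrank ℂ (spectralSubspace S {ζ | r < ζ.re}) := fun S ↦ by
    rw [← finrank_spectralSubspace_union]
    · refine congrArg (fun s ↦ finrank ℂ (spectralSubspace S s)) (Set.ext fun ζ ↦ ?_)
      refine ⟨fun h ↦ (le_or_gt ζ.re r).imp (fun h' ↦ ⟨h, h'⟩) id, ?_⟩
      rintro (h | h)
      · exact h.1
      · exact (neg_neg_of_pos hr).trans (hr.trans h)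
    · exact Set.disjoint_left.2 fun ζ h h' ↦ h.2.not_gt h'
  have hgap' : ∀ a : ℝ, |a| = r → ∀ μ : ℝ, (μ : ℂ) ∈ spectrum ℂ C → r ≤ |μ - a| := by
    intro a ha μ hμ
    rcases eq_or_ne μ 0 with rfl | hμ0
    · simp [ha]
    · linarith [hgap μ hμ hμ0, abs_sub_abs_le_abs_sub μ a]
  have hker : spectralSubspace C {ζ | -r < ζ.re ∧ ζ.re ≤ r} = LinearMap.ker C := by
    rw [← End.eigenspace_zero, ← spectralSubspace_singleton hC]
    refine spectralSubspace_congr C fun ζ hζ ↦ ⟨fun h ↦ ?_, ?_⟩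
    · by_contra hζ0
      rw [Set.mem_singleton_iff, ← ofReal_re_of_mem_spectrum hC hζ, Complex.ofReal_eq_zero] at hζ0
      rw [← ofReal_re_of_mem_spectrum hC hζ] at hζ
      linarith [hgap _ hζ hζ0, abs_le.2 ⟨h.1.le, h.2⟩]
    · rintro rfl
      simp [hr, hr.le]
  have hright := finrank_spectralSubspace_re_gt_eq_of_gap hC
    (hgap' r (abs_of_pos hr)) hT
  have hleft := finrank_spectralSubspace_re_gt_eq_of_gap hC
    (hgap' (-r) (by rw [abs_neg, abs_of_pos hr])) hT
  have hsT := hsplit T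
  have hsC := hsplit C
  rw [hker] at hsC
  omega

end Perturbation

section Overdamped

variable {E : Type*} [NormedAddCommGroup E] [InnerProductSpace ℂ E]

/-- The operator `Ω - i β B` of a system with frequency operator `Ω`, dissipation operator `B` and
dissipation strength `β`. -/
noncomputable def dampedOperator (Ω B : End ℂ E) (β : ℝ) : End ℂ E :=
  Ω - (Complex.I * (β : ℂ)) • B

theorem dampedOperator_apply (Ω B : End ℂ E) (β : ℝ) (x : E) :
    dampedOperator Ω B β x = Ω x - (Complex.I * (β : ℂ)) • B x :=
  rfl

/-- `Ω - i β B` is overdamped: a bound `ω` for the norm of the Hermitian operator `Ω` is less than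
half of `β b`, where `b` is a lower bound for the dissipation `B` on the orthogonal complement of
its kernel. -/
structure IsOverdamped (Ω B : End ℂ E) (ω b β : ℝ) : Prop where
  isSymmetric_left : Ω.IsSymmetric
  isSymmetric_right : B.IsSymmetric
  pos : 0 < ω
  norm_apply_le : ∀ x, ‖Ω x‖ ≤ ω * ‖x‖
  mul_norm_sq_le : ∀ x ∈ (LinearMap.ker B)ᗮ, b * ‖x‖ ^ 2 ≤ (⟪x, B x⟫_ℂ).re
  strength_pos : 0 < β
  two_mul_lt : 2 * ω < β * b

theorem im_inner_sub_smul_apply_add {T : End ℂ E} (hT : T.IsSymmetric) (y z : E) (t : ℝ) :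
    (⟪y - (t : ℂ) • z, T (y + z)⟫_ℂ).im = (1 + t) * (⟪y, T z⟫_ℂ).im := by
  have hy : (⟪y, T y⟫_ℂ).im = 0 := hT.im_inner_self_apply y
  have hz : (⟪z, T z⟫_ℂ).im = 0 := hT.im_inner_self_apply z
  have hzy : (⟪z, T y⟫_ℂ).im = -(⟪y, T z⟫_ℂ).im := by
    rw [← hT, ← inner_conj_symm, Complex.conj_im]
  rw [map_add, inner_sub_left, inner_smul_left, inner_add_right, inner_add_right,
    Complex.conj_ofReal, Complex.sub_im, Complex.im_ofReal_mul, Complex.add_im, Complex.add_im, hy,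
    hz, hzy]
  ring

theorem inner_sub_smul_apply_add_of_mem_ker {T : End ℂ E} (hT : T.IsSymmetric) (y : E) {z : E}
    (hz : z ∈ LinearMap.ker T) (c : ℂ) : ⟪y - c • z, T (y + z)⟫_ℂ = ⟪y, T y⟫_ℂ := by
  rw [map_add, LinearMap.mem_ker.1 hz, add_zero, inner_sub_left, inner_smul_left, ← hT z,
    LinearMap.mem_ker.1 hz, inner_zero_left, mul_zero, sub_zero]

theorem one_add_sq_mul_lt_sq_add_sq {s p q : ℝ} (hs₀ : 0 < s) (hs₁ : s < 1) (hp : 0 ≤ p)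
    (hq : 0 ≤ q) (hpq : 0 < p ^ 2 + q ^ 2) :
    (1 + s ^ 2) * (s * (p * q)) < p ^ 2 + s ^ 2 * q ^ 2 := by
  rcases (mul_nonneg hp hq).eq_or_lt with h0 | hpos
  · rw [← h0, mul_zero, mul_zero]
    rcases mul_eq_zero.1 h0.symm with rfl | rfl
    · have : 0 < q ^ 2 := by simpa using hpq
      positivity
    · have : 0 < p ^ 2 := by simpa using hpq
      positivity
  · calc (1 + s ^ 2) * (s * (p * q)) < 2 * (s * (p * q)) := by
          gcongr
          nlinarith
      _ ≤ p ^ 2 + s ^ 2 * q ^ 2 := by nlinarith [sq_nonneg (p - s * q)]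

namespace IsOverdamped

variable {Ω B : End ℂ E} {ω b β : ℝ}

theorem ratio_pos (h : IsOverdamped Ω B ω b β) : 0 < 2 * ω / (β * b) := by
  have hω := h.pos
  exact div_pos (by linarith) (by linarith [h.two_mul_lt])

theorem ratio_lt_one (h : IsOverdamped Ω B ω b β) : 2 * ω / (β * b) < 1 :=
  (div_lt_one (by linarith [h.pos, h.two_mul_lt])).2 h.two_mul_lt

variable [FiniteDimensional ℂ E]

theorem re_inner_indefiniteForm_add (h : IsOverdamped Ω B ω b β) {y z : E}
    (hy : y ∈ (LinearMap.ker B)ᗮ) (hz : z ∈ LinearMap.ker B) (t d : ℝ) :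
    (⟪indefiniteForm (LinearMap.ker B)ᗮ t (y + z),
      (Complex.I • dampedOperator Ω B β + (-d : ℂ) • 1) (y + z)⟫_ℂ).re =
      β * (⟪y, B y⟫_ℂ).re - (1 + t) * (⟪y, Ω z⟫_ℂ).im - d * (‖y‖ ^ 2 - t * ‖z‖ ^ 2) := by
  have hyz : ⟪y, z⟫_ℂ = 0 := Submodule.inner_left_of_mem_orthogonal hz hy
  have hself : (⟪y - (t : ℂ) • z, y + z⟫_ℂ).re = ‖y‖ ^ 2 - t * ‖z‖ ^ 2 := by
    rw [inner_sub_left, inner_smul_left, inner_add_right, inner_add_right, hyz,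
      inner_eq_zero_symm.1 hyz, Complex.conj_ofReal, add_zero, zero_add, Complex.sub_re,
      Complex.re_ofReal_mul, ← RCLike.re_eq_complex_re, inner_self_eq_norm_sq,
      inner_self_eq_norm_sq]
  have hI : ∀ x, (Complex.I • dampedOperator Ω B β + (-d : ℂ) • 1) x =
      Complex.I • Ω x + (β : ℂ) • B x - (d : ℂ) • x := fun x ↦ by
    simp only [LinearMap.add_apply, LinearMap.smul_apply, dampedOperator_apply, End.one_apply,
      smul_sub, smul_smul, ← mul_assoc, Complex.I_mul_I, neg_mul, one_mul, neg_smul,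
      LinearMap.neg_apply, sub_neg_eq_add, sub_eq_add_neg (_ + _)]
  rw [indefiniteForm_apply_add hy (Submodule.le_orthogonal_orthogonal _ hz), hI, inner_sub_right,
    inner_add_right, inner_smul_right, inner_smul_right, inner_smul_right,
    inner_sub_smul_apply_add_of_mem_ker h.isSymmetric_right y hz, Complex.sub_re, Complex.add_re,
    Complex.I_mul_re, im_inner_sub_smul_apply_add h.isSymmetric_left, Complex.re_ofReal_mul,
    Complex.re_ofReal_mul, hself]
  ring

theorem re_inner_indefiniteForm_pos (h : IsOverdamped Ω B ω b β) {x : E} (hx : x ≠ 0) :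
    0 < (⟪indefiniteForm (LinearMap.ker B)ᗮ ((2 * ω / (β * b)) ^ 2) x,
      (Complex.I • dampedOperator Ω B β + (-(β * b / 2 : ℝ) : ℂ) • 1) x⟫_ℂ).re := by
  obtain ⟨z, hz, y, hy, rfl⟩ := (LinearMap.ker B).exists_add_mem_mem_orthogonal x
  set s := 2 * ω / (β * b) with hs
  have hd : 0 < β * b := by linarith [h.pos, h.two_mul_lt]
  have hω : ω = s * (β * b) / 2 := by
    rw [hs, div_mul_cancel₀ _ hd.ne', mul_div_cancel_left₀ _ two_ne_zero]
  have hB : β * (b * ‖y‖ ^ 2) ≤ β * (⟪y, B y⟫_ℂ).re :=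
    mul_le_mul_of_nonneg_left (h.mul_norm_sq_le y hy) h.strength_pos.le
  have hΩ : (⟪y, Ω z⟫_ℂ).im ≤ ‖y‖ * (s * (β * b) / 2 * ‖z‖) := calc
    (⟪y, Ω z⟫_ℂ).im ≤ ‖⟪y, Ω z⟫_ℂ‖ := (le_abs_self _).trans (Complex.abs_im_le_norm _)
    _ ≤ ‖y‖ * ‖Ω z‖ := norm_inner_le_norm _ _
    _ ≤ ‖y‖ * (s * (β * b) / 2 * ‖z‖) := by
      rw [← hω]
      gcongr
      exact h.norm_apply_le z
  have hpq : 0 < ‖y‖ ^ 2 + ‖z‖ ^ 2 := by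
    rw [sq, sq, ← norm_add_sq_eq_norm_sq_add_norm_sq_of_inner_eq_zero y z
      (Submodule.inner_left_of_mem_orthogonal hz hy), add_comm y]
    have := norm_pos_iff.2 hx
    positivity
  have hamgm := mul_lt_mul_of_pos_left (one_add_sq_mul_lt_sq_add_sq h.ratio_pos h.ratio_lt_one
    (norm_nonneg y) (norm_nonneg z) hpq) (half_pos hd)
  have hcross := mul_le_mul_of_nonneg_left hΩ (by positivity : 0 ≤ 1 + s ^ 2)
  rw [add_comm z, h.re_inner_indefiniteForm_add hy hz]
  linarith

theorem finrank_spectralSubspace_high_and_low (h : IsOverdamped Ω B ω b β) :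
    finrank ℂ (spectralSubspace (dampedOperator Ω B β) {ζ | β * b / 2 < -ζ.im}) =
        finrank ℂ (LinearMap.ker B)ᗮ ∧
      finrank ℂ (spectralSubspace (dampedOperator Ω B β) {ζ | -ζ.im < β * b / 2}) =
        finrank ℂ (LinearMap.ker B) := by
  have hfinrank := finrank_spectralSubspace_re_pos_and_re_neg
    (fun x hx ↦ h.re_inner_indefiniteForm_pos hx) (sq_nonneg (2 * ω / (β * b)))
  rwa [spectralSubspace_I_smul_add_smul_one_re_pos, spectralSubspace_I_smul_add_smul_one_re_neg,
    Submodule.orthogonal_orthogonal] at hfinrank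

theorem norm_starProjection_orthogonal_lt (h : IsOverdamped Ω B ω b β) {x : E}
    (hx : x ∈ spectralSubspace (dampedOperator Ω B β) {ζ | -ζ.im < β * b / 2}) (hx0 : x ≠ 0) :
    ‖(LinearMap.ker B)ᗮ.starProjection x‖ <
      2 * ω / (β * b) * ‖(LinearMap.ker B).starProjection x‖ := by
  rw [← spectralSubspace_I_smul_add_smul_one_re_neg] at hx
  have hform := re_inner_neg_of_mem_spectralSubspace_re_neg
    (fun x hx ↦ h.re_inner_indefiniteForm_pos hx) hx hx0
  simp only [re_inner_indefiniteForm_self, Submodule.orthogonal_orthogonal, ← mul_pow] at hform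
  have := h.ratio_pos
  exact lt_of_pow_lt_pow_left₀ 2 (by positivity) (sub_neg.1 hform)

end IsOverdamped

end Overdamped

section LowLoss

variable {E : Type*} [NormedAddCommGroup E] [InnerProductSpace ℂ E] [FiniteDimensional ℂ E]

theorem exists_mem_spectrum_norm_add_le {Ω B : End ℂ E} {ω β : ℝ} (hB : B.IsSymmetric)
    (hΩ : ∀ x, ‖Ω x‖ ≤ ω * ‖x‖) {ζ : ℂ} (hζ : ζ ∈ spectrum ℂ (dampedOperator Ω B β)) :
    ∃ μ : ℝ, (μ : ℂ) ∈ spectrum ℂ B ∧ ‖Complex.I * β * μ + ζ‖ ≤ ω := by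
  obtain ⟨v, hv0, hv⟩ := mem_spectrum_iff_exists_apply_eq_smul.1 hζ
  refine exists_mem_spectrum_norm_le_of_isSymmetric hB hv0 ?_
  rw [← hv, dampedOperator_apply, add_sub_cancel]
  exact hΩ v

theorem neg_im_nonneg_of_mem_spectrum {Ω B : End ℂ E} {β : ℝ} (hΩ : Ω.IsSymmetric)
    (hB : ∀ x, 0 ≤ (⟪x, B x⟫_ℂ).re) (hβ : 0 ≤ β) {ζ : ℂ}
    (hζ : ζ ∈ spectrum ℂ (dampedOperator Ω B β)) : 0 ≤ -ζ.im := by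
  obtain ⟨v, hv0, hv⟩ := mem_spectrum_iff_exists_apply_eq_smul.1 hζ
  have him : (⟪v, dampedOperator Ω B β v⟫_ℂ).im = -(β * (⟪v, B v⟫_ℂ).re) := by
    have hΩv : (⟪v, Ω v⟫_ℂ).im = 0 := hΩ.im_inner_self_apply v
    rw [dampedOperator_apply, inner_sub_right, inner_smul_right, mul_assoc, Complex.sub_im, hΩv,
      Complex.I_mul_im, Complex.re_ofReal_mul, zero_sub]
  rw [hv, inner_smul_right, inner_self_eq_norm_sq_to_K, ← RCLike.ofReal_pow, mul_comm,
    RCLike.ofReal_eq_complex_ofReal, Complex.im_ofReal_mul] at him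
  have hv2 : 0 < ‖v‖ ^ 2 := pow_pos (norm_pos_iff.2 hv0) 2
  nlinarith [mul_nonneg hβ (hB v)]

namespace IsOverdamped

variable {Ω B : End ℂ E} {ω b β : ℝ}

theorem norm_starProjection_dampedOperator_sub_le (h : IsOverdamped Ω B ω b β) (x : E) :
    ‖(LinearMap.ker B).starProjection (dampedOperator Ω B β x) -
        (LinearMap.ker B).starProjection (Ω ((LinearMap.ker B).starProjection x))‖ ≤
      ω * ‖(LinearMap.ker B)ᗮ.starProjection x‖ := by
  set K := LinearMap.ker B
  have hB : K.starProjection (B x) = 0 := by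
    refine (Submodule.starProjection_apply_eq_zero_iff K).2 fun y hy ↦ ?_
    rw [← h.isSymmetric_right, LinearMap.mem_ker.1 hy, inner_zero_left]
  have hx : Kᗮ.starProjection x = x - K.starProjection x :=
    eq_sub_of_add_eq' (K.starProjection_add_starProjection_orthogonal x)
  rw [dampedOperator_apply, map_sub, map_smul, hB, smul_zero, sub_zero, ← map_sub, ← map_sub, ← hx]
  exact (K.norm_starProjection_apply_le _).trans (h.norm_apply_le _)

theorem norm_starProjection_dampedOperator_sub_lt (h : IsOverdamped Ω B ω b β) {x : E}
    (hx : x ∈ spectralSubspace (dampedOperator Ω B β) {ζ | -ζ.im < β * b / 2}) (hx0 : x ≠ 0) :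
    ‖(LinearMap.ker B).starProjection (dampedOperator Ω B β x) -
        (LinearMap.ker B).starProjection (Ω ((LinearMap.ker B).starProjection x))‖ <
      ω * (2 * ω / (β * b)) * ‖(LinearMap.ker B).starProjection x‖ := calc
  _ ≤ ω * ‖(LinearMap.ker B)ᗮ.starProjection x‖ := h.norm_starProjection_dampedOperator_sub_le x
  _ < ω * (2 * ω / (β * b) * ‖(LinearMap.ker B).starProjection x‖) :=
    mul_lt_mul_of_pos_left (h.norm_starProjection_orthogonal_lt hx hx0) h.pos
  _ = _ := (mul_assoc _ _ _).symm

theorem starProjection_ne_zero (h : IsOverdamped Ω B ω b β) {x : E}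
    (hx : x ∈ spectralSubspace (dampedOperator Ω B β) {ζ | -ζ.im < β * b / 2}) (hx0 : x ≠ 0) :
    (LinearMap.ker B).starProjection x ≠ 0 := fun h0 ↦ by
  have hlt := h.norm_starProjection_orthogonal_lt hx hx0
  rw [h0, norm_zero, mul_zero] at hlt
  exact (norm_nonneg _).not_gt hlt

theorem exists_mem_spectrum_compression_norm_sub_le (h : IsOverdamped Ω B ω b β) {ζ : ℂ}
    (hζ : ζ ∈ spectrum ℂ (dampedOperator Ω B β)) (hlow : -ζ.im < β * b / 2) :
    ∃ ρ : ℝ, (ρ : ℂ) ∈ spectrum ℂ (compression (LinearMap.ker B) Ω) ∧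
      ‖(ρ : ℂ) - ζ‖ ≤ ω * (2 * ω / (β * b)) := by
  obtain ⟨v, hv0, hv⟩ := mem_spectrum_iff_exists_apply_eq_smul.1 hζ
  have hvL := mem_spectralSubspace_of_apply_eq_smul (s := {ζ | -ζ.im < β * b / 2}) hlow hv
  have hlt := h.norm_starProjection_dampedOperator_sub_lt hvL hv0
  set K := LinearMap.ker B
  have hPv : K.orthogonalProjectionOnto v ≠ 0 := fun h0 ↦
    h.starProjection_ne_zero hvL hv0 (congrArg Subtype.val h0)
  have hbound : ‖(1 : ℂ) • compression K Ω (K.orthogonalProjectionOnto v) +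
      (-ζ) • K.orthogonalProjectionOnto v‖ ≤
        ω * (2 * ω / (β * b)) * ‖K.orthogonalProjectionOnto v‖ := by
    rw [hv, map_smul] at hlt
    rw [one_smul, neg_smul, ← sub_eq_add_neg, norm_sub_rev]
    exact hlt.le
  simpa only [one_mul, ← sub_eq_add_neg] using exists_mem_spectrum_norm_le_of_isSymmetric
    (isSymmetric_compression h.isSymmetric_left) hPv hbound

/-- The low-loss space contains no vector orthogonal to `Ker B` and has the dimension of `Ker B`, so
it is a graph over `Ker B`; transported to `Ker B`, the operator is a small perturbation of the
compression of `Ω`. -/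
theorem exists_dampedOperator_conj_near_compression (h : IsOverdamped Ω B ω b β) :
    ∃ (g : LinearMap.ker B →ₗ[ℂ] E) (T : End ℂ (LinearMap.ker B)), Function.Injective g ∧
      LinearMap.range g = spectralSubspace (dampedOperator Ω B β) {ζ | -ζ.im < β * b / 2} ∧
      (∀ x, g (T x) = dampedOperator Ω B β (g x)) ∧
      ∀ x, x ≠ 0 → ‖T x - compression (LinearMap.ker B) Ω x‖ < ω * (2 * ω / (β * b)) * ‖x‖ := by
  set K := LinearMap.ker B
  set L := spectralSubspace (dampedOperator Ω B β) {ζ | -ζ.im < β * b / 2}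
  let p : L →ₗ[ℂ] K := K.orthogonalProjectionOnto.toLinearMap ∘ₗ L.subtype
  have hp : Function.Injective p := (injective_iff_map_eq_zero p).2 fun x hx ↦ by
    by_contra hx0
    exact h.starProjection_ne_zero x.2 (by simpa using hx0) (congrArg Subtype.val hx)
  let e : L ≃ₗ[ℂ] K := LinearEquiv.ofBijective p ⟨hp,
    (LinearMap.injective_iff_surjective_of_finrank_eq_finrank
      h.finrank_spectralSubspace_high_and_low.2).1 hp⟩
  let A : End ℂ L := (dampedOperator Ω B β).restrict (apply_mem_spectralSubspace _ _)
  refine ⟨L.subtype ∘ₗ e.symm.toLinearMap, e.conj A, L.subtype_injective.comp e.symm.injective,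
    ?_, fun x ↦ ?_, fun x hx ↦ ?_⟩
  · rw [LinearMap.range_comp_of_range_eq_top _ e.symm.range, Submodule.range_subtype]
  · simp [A, LinearEquiv.conj_apply]
  · obtain ⟨y, rfl⟩ := e.surjective x
    have hlt := h.norm_starProjection_dampedOperator_sub_lt y.2
      (by simpa using (map_ne_zero_iff e e.injective).1 hx)
    rw [LinearEquiv.conj_apply_apply, e.symm_apply_apply]
    exact hlt

theorem finrank_spectralSubspace_low_strip_eq_finrank_ker (h : IsOverdamped Ω B ω b β) {r : ℝ}
    (hr : ω * (2 * ω / (β * b)) ≤ r)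
    (hgap : ∀ μ : ℝ, (μ : ℂ) ∈ spectrum ℂ (compression (LinearMap.ker B) Ω) → μ ≠ 0 →
      2 * r ≤ |μ|) :
    finrank ℂ (spectralSubspace (dampedOperator Ω B β)
        ({ζ | -ζ.im < β * b / 2} ∩ {ζ | -r < ζ.re ∧ ζ.re ≤ r})) =
      finrank ℂ (LinearMap.ker (compression (LinearMap.ker B) Ω)) := by
  obtain ⟨g, T, hg, hrange, hgT, hT⟩ := h.exists_dampedOperator_conj_near_compression
  have hr0 : 0 < r := (mul_pos h.pos h.ratio_pos).trans_le hr
  rw [spectralSubspace_inter, ← hrange, ← Submodule.map_comap_eq, comap_spectralSubspace hg hgT,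
    ← (Submodule.equivMapOfInjective g hg _).finrank_eq]
  exact finrank_spectralSubspace_strip_eq_finrank_ker (isSymmetric_compression h.isSymmetric_left)
    hr0 hgap fun x hx ↦ (hT x hx).trans_le (mul_le_mul_of_nonneg_right hr (norm_nonneg x))

end IsOverdamped

end LowLoss

section CompressionRank

variable {E : Type*} [NormedAddCommGroup E] [InnerProductSpace ℂ E] [FiniteDimensional ℂ E]

theorem finrank_range_of_comap_orthogonal_eq {C : End ℂ E} (hC : C.IsSymmetric)
    {V : Submodule ℂ E} (hV : Vᗮ.comap C = V) :
    finrank ℂ (LinearMap.range C) = 2 * (finrank ℂ E - finrank ℂ V) := by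
  have hker : LinearMap.ker C ≤ V := by
    rw [← hV]
    exact fun x hx ↦ by simp [LinearMap.mem_ker.1 hx]
  have hrange : Vᗮ ≤ LinearMap.range C := by
    rw [← Submodule.orthogonal_orthogonal (LinearMap.range C), hC.orthogonal_range]
    exact Submodule.orthogonal_le hker
  have hmap : V.map C = Vᗮ := by
    conv_lhs => rw [← hV]
    rw [Submodule.map_comap_eq, inf_eq_right.2 hrange]
  have hVrank := (C.domRestrict V).finrank_range_add_finrank_ker
  rw [LinearMap.range_domRestrict, hmap, LinearMap.ker_domRestrict,
    (Submodule.comapSubtypeEquivOfLe hker).finrank_eq] at hVrank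
  have hCrank := C.finrank_range_add_finrank_ker
  have hVorth := V.finrank_add_finrank_orthogonal
  omega

variable (K : Submodule ℂ E) (T : End ℂ E)

theorem starProjection_mul_mul_starProjection_eq :
    K.starProjection.toLinearMap * T * K.starProjection.toLinearMap =
      K.subtype ∘ₗ compression K T ∘ₗ K.orthogonalProjectionOnto.toLinearMap :=
  rfl

theorem mem_spectrum_of_mem_spectrum_compression {ζ : ℂ}
    (hζ : ζ ∈ spectrum ℂ (compression K T)) :
    ζ ∈ spectrum ℂ (K.starProjection.toLinearMap * T * K.starProjection.toLinearMap) := by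
  obtain ⟨x, hx0, hx⟩ := mem_spectrum_iff_exists_apply_eq_smul.1 hζ
  refine mem_spectrum_iff_exists_apply_eq_smul.2 ⟨x, by simpa using hx0, ?_⟩
  rw [starProjection_mul_mul_starProjection_eq]
  simp [hx]

theorem finrank_range_starProjection_mul_mul_starProjection :
    finrank ℂ (LinearMap.range
      (K.starProjection.toLinearMap * T * K.starProjection.toLinearMap)) =
      finrank ℂ (LinearMap.range (compression K T)) := by
  have hsurj : LinearMap.range K.orthogonalProjectionOnto.toLinearMap = ⊤ :=
    LinearMap.range_eq_top.2 fun x ↦ ⟨x, by simp⟩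
  rw [starProjection_mul_mul_starProjection_eq, LinearMap.range_comp,
    LinearMap.range_comp_of_range_eq_top _ hsurj, Submodule.finrank_map_subtype_eq]

end CompressionRank

section RealSpectrum

variable {E : Type*} [NormedAddCommGroup E] [InnerProductSpace ℂ E] [FiniteDimensional ℂ E]

theorem finite_setOf_ofReal_mem_spectrum (T : End ℂ E) : {x : ℝ | (x : ℂ) ∈ spectrum ℂ T}.Finite :=
  (End.finite_spectrum T).preimage Complex.ofReal_injective.injOn

theorem exists_ofReal_mem_spectrum_ne_zero {T : End ℂ E} (hT : T.IsSymmetric) (hT0 : T ≠ 0) :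
    ∃ x : ℝ, x ≠ 0 ∧ (x : ℂ) ∈ spectrum ℂ T := by
  by_contra! h
  refine hT0 (LinearMap.ext fun x ↦ norm_le_zero_iff.1 ?_)
  simpa using norm_apply_le_of_forall_mem_spectrum hT le_rfl
    (fun μ hμ ↦ (abs_eq_zero.2 (by_contra fun hμ0 ↦ h μ hμ0 hμ)).le) x

variable {J : E →ₗ⋆[ℂ] E}

theorem neg_conj_mem_spectrum_of_anticommute (hJ : Function.Injective J) {T : End ℂ E}
    (hT : ∀ x, T (J x) = -J (T x)) {ζ : ℂ} (hζ : ζ ∈ spectrum ℂ T) :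
    -(starRingEnd ℂ ζ) ∈ spectrum ℂ T := by
  obtain ⟨v, hv0, hv⟩ := mem_spectrum_iff_exists_apply_eq_smul.1 hζ
  refine mem_spectrum_iff_exists_apply_eq_smul.2 ⟨J v, (map_ne_zero_iff J hJ).2 hv0, ?_⟩
  rw [hT, hv, map_smulₛₗ, neg_smul]

theorem starProjection_apply_of_antiunitary_involution (hJ : Function.Involutive J)
    (hinner : ∀ x y, ⟪J x, J y⟫_ℂ = starRingEnd ℂ ⟪x, y⟫_ℂ) {K : Submodule ℂ E}
    (hK : ∀ x ∈ K, J x ∈ K) (x : E) : K.starProjection (J x) = J (K.starProjection x) := by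
  refine Submodule.eq_starProjection_of_mem_orthogonal
    (hK _ (K.starProjection_apply_mem x)) fun y hy ↦ ?_
  rw [← map_sub, ← hJ y, hinner, K.sub_starProjection_mem_orthogonal x _ (hK y hy), map_zero]

end RealSpectrum

section ComplexConjugation

variable {ι : Type*}

/-- Entrywise complex conjugation as a conjugate-linear map. It anticommutes with the frequency
operator of a Lagrangian system, which makes the spectrum symmetric about `0`. -/
def complexConjugation : EuclideanSpace ℂ ι →ₗ⋆[ℂ] EuclideanSpace ℂ ι where
  toFun x := WithLp.toLp 2 (star x.ofLp)
  map_add' x y := by ext i; simp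
  map_smul' a x := by ext i; simp

theorem complexConjugation_apply (x : EuclideanSpace ℂ ι) (i : ι) :
    complexConjugation x i = star (x i) :=
  rfl

theorem involutive_complexConjugation :
    Function.Involutive (complexConjugation (ι := ι)) := fun x ↦ by
  ext i
  simp [complexConjugation_apply]

variable [Fintype ι]

theorem inner_complexConjugation (x y : EuclideanSpace ℂ ι) :
    ⟪complexConjugation x, complexConjugation y⟫_ℂ = starRingEnd ℂ ⟪x, y⟫_ℂ := by
  simp [complexConjugation_apply, PiLp.inner_apply]

theorem toEuclideanLin_complexConjugation [DecidableEq ι] (M : Matrix ι ι ℂ)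
    (x : EuclideanSpace ℂ ι) :
    Matrix.toEuclideanLin M (complexConjugation x) =
      complexConjugation (Matrix.toEuclideanLin (M.map star) x) := by
  ext i
  simp [complexConjugation_apply, Matrix.toLpLin_apply, Matrix.mulVec, dotProduct]

end ComplexConjugation

section RealMatrix

open Matrix

variable {m : Type*}

theorem rank_matrix_map [Fintype m] {K L : Type*} [Field K] [Field L] (f : K →+* L)
    (M : Matrix m m K) :
    (M.map f).rank = M.rank := by
  classical
  obtain ⟨V, U, e, hV, hU, hVMU⟩ := M.exists_rank_normal_form
  have hVf := (isUnit_iff_isUnit_det _).1 (hV.map f.mapMatrix)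
  have hUf := (isUnit_iff_isUnit_det _).1 (hU.map f.mapMatrix)
  have hmap : (f.mapMatrix V * M.map f * f.mapMatrix U).rank =
      ((diagonal (Sum.elim 1 0)).submatrix e e : Matrix m m L).rank := by
    rw [← f.mapMatrix_apply, ← map_mul, ← map_mul, hVMU, f.mapMatrix_apply, ← submatrix_map,
      fromBlocks_map, ← fromBlocks_diagonal]
    simp
  rw [rank_mul_eq_left_of_isUnit_det _ _ hUf, rank_mul_eq_right_of_isUnit_det _ _ hVf,
    rank_submatrix, rank_diagonal, Fintype.card_congr Equiv.subtypeSum] at hmap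
  simpa using hmap

open scoped ComplexOrder MatrixOrder in
theorem posSemidef_map_ofReal [Finite m] {M : Matrix m m ℝ} (hM : M.PosSemidef) :
    (M.map Complex.ofReal).PosSemidef := by
  classical
  cases nonempty_fintype m
  obtain ⟨Q, rfl⟩ := CStarAlgebra.nonneg_iff_eq_star_mul_self.mp hM.nonneg
  have hmap : (star Q * Q).map Complex.ofReal =
      (Q.map Complex.ofReal)ᴴ * Q.map Complex.ofReal := by
    ext i j
    simp [star_eq_conjTranspose, mul_apply]
  exact hmap ▸ posSemidef_conjTranspose_mul_self _

theorem posSemidef_fromBlocks_zero {R n : Type*} [Ring R] [PartialOrder R] [StarRing R]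
    [Finite m] [Finite n] {X : Matrix m m R} (hX : X.PosSemidef) :
    (fromBlocks X 0 0 (0 : Matrix n n R)).PosSemidef := by
  classical
  cases nonempty_fintype m
  cases nonempty_fintype n
  let C : Matrix m (m ⊕ n) R := fromCols 1 0
  have hblock : fromBlocks X 0 0 0 = Cᴴ * X * C := by
    rw [conjTranspose_fromCols_eq_fromRows_conjTranspose, fromRows_mul, fromRows_mul_fromCols]
    simp
  exact hblock ▸ hX.conjTranspose_mul_mul_same C

end RealMatrix

namespace LagrangianSystem

section Operators

variable {N : ℕ} (S : LagrangianSystem N)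

theorem Omega_complexConjugation (x : PhaseSpace N) :
    S.Omega (complexConjugation x) = -complexConjugation (S.Omega x) := by
  have hconj : S.OmegaMatrix.map star = -S.OmegaMatrix := by
    have htwo : starRingEnd ℂ 2 = 2 := Complex.conj_ofNat 2
    rw [OmegaMatrix, Matrix.fromBlocks_map, Matrix.fromBlocks_neg]
    congr 1 <;> ext i j <;> simp [htwo]
  rw [Omega, toEuclideanLin_complexConjugation, hconj, map_neg, LinearMap.neg_apply, map_neg]

theorem B_complexConjugation (x : PhaseSpace N) :
    S.B (complexConjugation x) = complexConjugation (S.B x) := by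
  have hconj : S.BMatrix.map star = S.BMatrix := by
    rw [BMatrix, Matrix.fromBlocks_map]
    congr 1 <;> ext i j <;> simp
  rw [B, toEuclideanLin_complexConjugation, hconj]

theorem projKerB_complexConjugation (x : PhaseSpace N) :
    S.projKerB (complexConjugation x) = complexConjugation (S.projKerB x) :=
  starProjection_apply_of_antiunitary_involution involutive_complexConjugation
    inner_complexConjugation (fun y hy ↦ by
      rw [LinearMap.mem_ker, B_complexConjugation, LinearMap.mem_ker.1 hy, map_zero]) x

theorem compressedOmega_complexConjugation (x : PhaseSpace N) :
    S.compressedOmega (complexConjugation x) = -complexConjugation (S.compressedOmega x) := by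
  simp only [compressedOmega, End.mul_apply, projKerB_complexConjugation, Omega_complexConjugation,
    map_neg]

theorem isSymmetric_Omega : S.Omega.IsSymmetric := by
  have hskew : ((S.Kp * S.θ * S.Kp.transpose).map Complex.ofReal).conjTranspose =
      -(S.Kp * S.θ * S.Kp.transpose).map Complex.ofReal := by
    rw [← Matrix.conjTranspose_map Complex.ofReal fun x ↦ by simp,
      Matrix.conjTranspose_eq_transpose_of_trivial, Matrix.transpose_mul, Matrix.transpose_mul,
      S.θ_skew, Matrix.transpose_transpose]
    ext i j
    simp [Matrix.mul_assoc]
  rw [Omega, Matrix.isSymmetric_toEuclideanLin_iff, OmegaMatrix, Matrix.IsHermitian,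
    Matrix.fromBlocks_conjTranspose, Matrix.conjTranspose_smul, hskew]
  congr 1 <;> ext i j <;> simp

theorem isSymmetric_compressedOmega : S.compressedOmega.IsSymmetric := fun x y ↦ by
  have hproj := Submodule.starProjection_isSymmetric (LinearMap.ker S.B)
  simp only [compressedOmega, projKerB, End.mul_apply]
  rw [hproj, S.isSymmetric_Omega, hproj]

open scoped ComplexOrder in
theorem posSemidef_BMatrix : S.BMatrix.PosSemidef :=
  posSemidef_fromBlocks_zero <| posSemidef_map_ofReal <|
    S.R_posSemidef.mul_mul_conjTranspose_same S.Kp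

open scoped ComplexOrder in
theorem isSymmetric_B : S.B.IsSymmetric :=
  Matrix.isSymmetric_toEuclideanLin_iff.2 S.posSemidef_BMatrix.1

open scoped ComplexOrder in
theorem re_inner_B_nonneg (x : PhaseSpace N) : 0 ≤ (⟪x, S.B x⟫_ℂ).re :=
  (Matrix.isPositive_toEuclideanLin_iff.2 S.posSemidef_BMatrix).re_inner_nonneg_right x

end Operators

section Rank

/-- The projection of `ℂ^N ⊕ ℂ^N` onto its first summand. The range of `B` lies in that summand, and
its complement is the kernel of this map. -/
def firstComponent (N : ℕ) : PhaseSpace N →ₗ[ℂ] (Fin N → ℂ) :=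
  LinearMap.funLeft ℂ ℂ Sum.inl ∘ₗ (WithLp.linearEquiv 2 ℂ (Fin N ⊕ Fin N → ℂ)).toLinearMap

variable {N : ℕ} (S : LagrangianSystem N)

theorem firstComponent_apply (x : PhaseSpace N) : firstComponent N x = x.ofLp ∘ Sum.inl :=
  rfl

theorem range_firstComponent : LinearMap.range (firstComponent N) = ⊤ :=
  LinearMap.range_eq_top.2 <| (LinearMap.funLeft_surjective_of_injective ℂ ℂ _
    Sum.inl_injective).comp (WithLp.linearEquiv 2 ℂ (Fin N ⊕ Fin N → ℂ)).surjective

theorem finrank_phaseSpace : finrank ℂ (PhaseSpace N) = 2 * N := by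
  simp [two_mul]

theorem finrank_ker_firstComponent : finrank ℂ (LinearMap.ker (firstComponent N)) = N := by
  have hdim := (firstComponent N).finrank_range_add_finrank_ker
  rw [range_firstComponent, finrank_top, finrank_phaseSpace, finrank_fin_fun] at hdim
  omega

theorem isUnit_Kp : IsUnit S.Kp := by
  open scoped MatrixOrder Matrix.Norms.L2Operator in
  exact Matrix.isUnit_nonsing_inv_iff.2 <|
    (CFC.isUnit_sqrt_iff S.α S.α_posDef.posSemidef.nonneg).2 S.α_posDef.isUnit

theorem Kq_mul_Kq : S.Kq * S.Kq = S.η := by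
  open scoped MatrixOrder Matrix.Norms.L2Operator in
  exact CFC.sqrt_mul_sqrt_self S.η S.η_posSemidef.nonneg

theorem rank_Kp_mul_R_mul_Kp_transpose :
    ((S.Kp * S.R * S.Kp.transpose).map Complex.ofReal).rank = S.R.rank := by
  have hKp := (Matrix.isUnit_iff_isUnit_det _).1 S.isUnit_Kp
  refine (rank_matrix_map Complex.ofRealHom _).trans ?_
  rw [Matrix.rank_mul_eq_left_of_isUnit_det _ _ (by rwa [Matrix.det_transpose]),
    Matrix.rank_mul_eq_right_of_isUnit_det _ _ hKp]

theorem ker_B_eq_ker : LinearMap.ker S.B = LinearMap.ker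
    (((S.Kp * S.R * S.Kp.transpose).map Complex.ofReal).mulVecLin ∘ₗ firstComponent N) := by
  ext x
  rw [LinearMap.mem_ker, B, Matrix.toLpLin_apply, BMatrix, Matrix.fromBlocks_mulVec,
    WithLp.toLp_eq_zero, LinearMap.mem_ker, LinearMap.comp_apply, Matrix.mulVecLin_apply,
    firstComponent_apply]
  constructor
  · intro hx
    simpa using congrArg (· ∘ Sum.inl) hx
  · intro hx
    ext (i | i) <;> simp [hx]

theorem finrank_ker_B : finrank ℂ (LinearMap.ker S.B) + S.R.rank = 2 * N := by
  rw [ker_B_eq_ker, ← finrank_phaseSpace, ← S.rank_Kp_mul_R_mul_Kp_transpose, Matrix.rank,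
    ← LinearMap.range_comp_of_range_eq_top _ range_firstComponent, add_comm]
  exact LinearMap.finrank_range_add_finrank_ker _

theorem ker_firstComponent_le_ker_B : LinearMap.ker (firstComponent N) ≤ LinearMap.ker S.B := by
  rw [ker_B_eq_ker]
  exact LinearMap.ker_le_ker_comp _ _

theorem Omega_apply_inr (x : PhaseSpace N) (i : Fin N) :
    S.Omega x (Sum.inr i) =
      Complex.I * ((S.Phi.map Complex.ofReal).mulVec (firstComponent N x)) i := by
  rw [Omega, OmegaMatrix, Matrix.toLpLin_apply, Matrix.fromBlocks_mulVec, firstComponent_apply]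
  simp [Matrix.smul_mulVec]

theorem Omega_mem_orthogonal_ker_firstComponent_iff {x : PhaseSpace N} :
    S.Omega x ∈ (LinearMap.ker (firstComponent N))ᗮ ↔
      (S.Phi.map Complex.ofReal).mulVec (firstComponent N x) = 0 := by
  constructor
  · refine fun hx ↦ funext fun i ↦ ?_
    have hi := hx (EuclideanSpace.single (Sum.inr i) 1) (by
      ext j
      simp [firstComponent_apply])
    simpa [EuclideanSpace.inner_single_left, Omega_apply_inr] using hi
  · intro hx w hw
    have hinl : ∀ i, w (Sum.inl i) = 0 := congrFun (LinearMap.mem_ker.1 hw)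
    simp [PiLp.inner_apply, hinl, Omega_apply_inr, hx]

theorem firstComponent_eq_zero_of_mulVec_eq_zero
    (hker : LinearMap.ker (Matrix.toLin' (S.R.map Complex.ofReal)) ⊓
      LinearMap.ker (Matrix.toLin' (S.η.map Complex.ofReal)) = ⊥) {x : PhaseSpace N}
    (hx : x ∈ LinearMap.ker S.B)
    (hΦ : (S.Phi.map Complex.ofReal).mulVec (firstComponent N x) = 0) :
    firstComponent N x = 0 := by
  have hmap : ∀ M M' : Matrix (Fin N) (Fin N) ℝ,
      (M * M').map Complex.ofReal = M.map Complex.ofReal * M'.map Complex.ofReal :=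
    Complex.ofRealHom.mapMatrix.map_mul
  have hinj : ∀ {M : Matrix (Fin N) (Fin N) ℝ}, IsUnit M → ∀ {u},
      (M.map Complex.ofReal).mulVec u = 0 → u = 0 := fun hM _ hu ↦
    Matrix.mulVec_injective_of_isUnit (hM.map Complex.ofRealHom.mapMatrix)
      (hu.trans (Matrix.mulVec_zero _).symm)
  set w := (S.Kp.transpose.map Complex.ofReal).mulVec (firstComponent N x) with hw
  have hR : (S.R.map Complex.ofReal).mulVec w = 0 := by
    rw [ker_B_eq_ker, LinearMap.mem_ker, LinearMap.comp_apply, Matrix.mulVecLin_apply, hmap, hmap,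
      Matrix.mul_assoc, ← Matrix.mulVec_mulVec, ← Matrix.mulVec_mulVec] at hx
    exact hinj S.isUnit_Kp hx
  have hη : (S.η.map Complex.ofReal).mulVec w = 0 := by
    rw [Phi, hmap, ← Matrix.mulVec_mulVec] at hΦ
    rw [← S.Kq_mul_Kq, hmap, ← Matrix.mulVec_mulVec, hw, hΦ, Matrix.mulVec_zero]
  have hw0 : w ∈ (⊥ : Submodule ℂ (Fin N → ℂ)) := hker ▸ ⟨hR, hη⟩
  exact hinj ((Matrix.isUnit_transpose _).2 S.isUnit_Kp) hw0

theorem comap_compression_orthogonal_ker_firstComponent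
    (hker : LinearMap.ker (Matrix.toLin' (S.R.map Complex.ofReal)) ⊓
      LinearMap.ker (Matrix.toLin' (S.η.map Complex.ofReal)) = ⊥) :
    ((LinearMap.ker (firstComponent N)).comap (LinearMap.ker S.B).subtype)ᗮ.comap
        (compression (LinearMap.ker S.B) S.Omega) =
      (LinearMap.ker (firstComponent N)).comap (LinearMap.ker S.B).subtype := by
  ext x
  have horth : compression (LinearMap.ker S.B) S.Omega x ∈
      ((LinearMap.ker (firstComponent N)).comap (LinearMap.ker S.B).subtype)ᗮ ↔
      S.Omega x ∈ (LinearMap.ker (firstComponent N))ᗮ :=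
    ⟨fun hx w hw ↦ (inner_compression_right (T := S.Omega)
        (⟨w, S.ker_firstComponent_le_ker_B hw⟩ : LinearMap.ker S.B) x).symm.trans (hx _ hw),
      fun hx w hw ↦ (inner_compression_right (T := S.Omega) w x).trans (hx _ hw)⟩
  rw [Submodule.mem_comap, horth, Omega_mem_orthogonal_ker_firstComponent_iff]
  refine ⟨S.firstComponent_eq_zero_of_mulVec_eq_zero hker x.2, fun hx ↦ ?_⟩
  rw [show firstComponent N x = 0 from hx, Matrix.mulVec_zero]

theorem finrank_range_compressedOmega_eq_finrank_range_compression :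
    finrank ℂ (LinearMap.range S.compressedOmega) =
      finrank ℂ (LinearMap.range (compression (LinearMap.ker S.B) S.Omega)) :=
  finrank_range_starProjection_mul_mul_starProjection (LinearMap.ker S.B) S.Omega

theorem finrank_range_compressedOmega
    (hker : LinearMap.ker (Matrix.toLin' (S.R.map Complex.ofReal)) ⊓
      LinearMap.ker (Matrix.toLin' (S.η.map Complex.ofReal)) = ⊥) :
    finrank ℂ (LinearMap.range S.compressedOmega) = 2 * (N - S.R.rank) := by
  have hdim := S.finrank_ker_B
  rw [finrank_range_compressedOmega_eq_finrank_range_compression,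
    finrank_range_of_comap_orthogonal_eq (isSymmetric_compression S.isSymmetric_Omega)
      (S.comap_compression_orthogonal_ker_firstComponent hker),
    (Submodule.comapSubtypeEquivOfLe S.ker_firstComponent_le_ker_B).finrank_eq,
    finrank_ker_firstComponent]
  omega

end Rank

end LagrangianSystem

namespace LagrangianSystem

section Parameters

variable {N : ℕ} (S : LagrangianSystem N)

theorem abs_le_omegaMax {μ : ℝ} (hμ : (μ : ℂ) ∈ spectrum ℂ S.Omega) : |μ| ≤ S.omegaMax := by
  have hle : ∀ x : ℝ, (x : ℂ) ∈ spectrum ℂ S.Omega → x ≤ S.omegaMax := fun x hx ↦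
    le_csSup (finite_setOf_ofReal_mem_spectrum _).bddAbove hx
  refine abs_le'.2 ⟨hle μ hμ, hle _ ?_⟩
  simpa using neg_conj_mem_spectrum_of_anticommute involutive_complexConjugation.injective
    S.Omega_complexConjugation hμ

theorem omegaMax_nonneg : 0 ≤ S.omegaMax := by
  rcases Set.eq_empty_or_nonempty {x : ℝ | (x : ℂ) ∈ spectrum ℂ S.Omega} with h | ⟨x, hx⟩
  · rw [omegaMax, h, Real.sSup_empty]
  · exact (abs_nonneg x).trans (S.abs_le_omegaMax hx)

theorem norm_Omega_apply_le (x : PhaseSpace N) : ‖S.Omega x‖ ≤ S.omegaMax * ‖x‖ :=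
  norm_apply_le_of_forall_mem_spectrum S.isSymmetric_Omega S.omegaMax_nonneg
    (fun _ ↦ S.abs_le_omegaMax) x

theorem B_ne_zero : S.B ≠ 0 := by
  intro hB
  have hdim := S.finrank_ker_B
  rw [hB, LinearMap.ker_zero, finrank_top, finrank_phaseSpace] at hdim
  have := S.rank_R_pos
  omega

theorem bMin_mem : S.bMin ≠ 0 ∧ (S.bMin : ℂ) ∈ spectrum ℂ S.B :=
  Set.Nonempty.csInf_mem (exists_ofReal_mem_spectrum_ne_zero S.isSymmetric_B S.B_ne_zero)
    ((finite_setOf_ofReal_mem_spectrum S.B).subset fun _ hx ↦ hx.2)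

theorem bMin_le {b : ℝ} (hb0 : b ≠ 0) (hb : (b : ℂ) ∈ spectrum ℂ S.B) : S.bMin ≤ b :=
  csInf_le ((finite_setOf_ofReal_mem_spectrum S.B).subset fun _ hx ↦ hx.2).bddBelow ⟨hb0, hb⟩

theorem bMin_pos : 0 < S.bMin := by
  obtain ⟨v, hv0, hv⟩ := mem_spectrum_iff_exists_apply_eq_smul.1 S.bMin_mem.2
  have hnonneg : 0 ≤ S.bMin * ‖v‖ ^ 2 := by
    simpa [hv, inner_smul_right, ← Complex.ofReal_pow] using S.re_inner_B_nonneg v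
  exact (nonneg_of_mul_nonneg_left hnonneg (pow_pos (norm_pos_iff.2 hv0) 2)).lt_of_ne'
    S.bMin_mem.1

theorem bMin_mul_norm_sq_le {x : PhaseSpace N} (hx : x ∈ (LinearMap.ker S.B)ᗮ) :
    S.bMin * ‖x‖ ^ 2 ≤ (⟪x, S.B x⟫_ℂ).re := by
  refine mul_norm_sq_le_re_inner_apply S.isSymmetric_B fun μ v hv hvx ↦ S.bMin_le ?_ ?_
  · rintro rfl
    exact hvx (hx v (by rw [LinearMap.mem_ker, hv, Complex.ofReal_zero, zero_smul]))
  · exact mem_spectrum_iff_exists_apply_eq_smul.2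
      ⟨v, fun hv0 ↦ hvx (by rw [hv0, inner_zero_left]), hv⟩

theorem norm_compressedOmega_apply_le (x : PhaseSpace N) :
    ‖S.compressedOmega x‖ ≤ S.omegaMax * ‖x‖ := by
  set P := (LinearMap.ker S.B).starProjection
  calc ‖S.compressedOmega x‖ ≤ ‖S.Omega (P x)‖ := (LinearMap.ker S.B).norm_starProjection_apply_le _
    _ ≤ S.omegaMax * ‖P x‖ := S.norm_Omega_apply_le _
    _ ≤ S.omegaMax * ‖x‖ := mul_le_mul_of_nonneg_left
        ((LinearMap.ker S.B).norm_starProjection_apply_le x) S.omegaMax_nonneg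

theorem abs_mem_spectrum_compressedOmega {ρ : ℝ} (hρ : (ρ : ℂ) ∈ spectrum ℂ S.compressedOmega) :
    ((|ρ| : ℝ) : ℂ) ∈ spectrum ℂ S.compressedOmega := by
  have hneg := neg_conj_mem_spectrum_of_anticommute involutive_complexConjugation.injective
    S.compressedOmega_complexConjugation hρ
  rcases abs_choice ρ with h | h <;> rw [h]
  · exact hρ
  · simpa using hneg

theorem rhoMin_le_abs {ρ : ℝ} (hρ0 : ρ ≠ 0) (hρ : (ρ : ℂ) ∈ spectrum ℂ S.compressedOmega) :
    S.rhoMin ≤ |ρ| :=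
  csInf_le ((finite_setOf_ofReal_mem_spectrum _).subset fun _ hx ↦ hx.2).bddBelow
    ⟨abs_pos.2 hρ0, S.abs_mem_spectrum_compressedOmega hρ⟩

theorem rhoMin_mem (hΩ : S.compressedOmega ≠ 0) :
    0 < S.rhoMin ∧ (S.rhoMin : ℂ) ∈ spectrum ℂ S.compressedOmega := by
  obtain ⟨ρ, hρ0, hρ⟩ := exists_ofReal_mem_spectrum_ne_zero S.isSymmetric_compressedOmega hΩ
  have hne : {x : ℝ | 0 < x ∧ (x : ℂ) ∈ spectrum ℂ S.compressedOmega}.Nonempty :=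
    ⟨|ρ|, abs_pos.2 hρ0, S.abs_mem_spectrum_compressedOmega hρ⟩
  exact hne.csInf_mem ((finite_setOf_ofReal_mem_spectrum _).subset fun _ hx ↦ hx.2)

theorem rhoMin_le_omegaMax (hΩ : S.compressedOmega ≠ 0) : S.rhoMin ≤ S.omegaMax := by
  obtain ⟨hpos, hmem⟩ := S.rhoMin_mem hΩ
  obtain ⟨v, hv0, hv⟩ := mem_spectrum_iff_exists_apply_eq_smul.1 hmem
  have hle := S.norm_compressedOmega_apply_le v
  rw [hv, norm_smul, Complex.norm_real, Real.norm_of_nonneg hpos.le] at hle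
  exact le_of_mul_le_mul_right hle (norm_pos_iff.2 hv0)

variable {β : ℝ}

theorem two_mul_omegaMax_div_bMin_lt (hΩ : S.compressedOmega ≠ 0)
    (hβ : S.cInv (S.rhoMin / 2) < β) : 2 * S.omegaMax / S.bMin < β := by
  have hb := S.bMin_pos
  have hρ := (S.rhoMin_mem hΩ).1
  have hc : 0 ≤ 2 * S.omegaMax ^ 2 / S.bMin * (S.rhoMin / 2)⁻¹ := by positivity
  rw [cInv] at hβ
  linarith

theorem c_lt (hΩ : S.compressedOmega ≠ 0) (hβ : S.cInv (S.rhoMin / 2) < β) :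
    S.c β < S.rhoMin / 2 := by
  have hlt := S.two_mul_omegaMax_div_bMin_lt hΩ hβ
  have hρ := (S.rhoMin_mem hΩ).1
  rw [cInv, ← lt_sub_iff_add_lt, ← div_eq_mul_inv, div_lt_iff₀ (half_pos hρ)] at hβ
  rw [c, ← div_eq_mul_inv, div_lt_iff₀ (by linarith)]
  linarith

theorem isOverdamped (hΩ : S.compressedOmega ≠ 0) (hβ : S.cInv (S.rhoMin / 2) < β) :
    IsOverdamped S.Omega S.B S.omegaMax S.bMin β where
  isSymmetric_left := S.isSymmetric_Omega
  isSymmetric_right := S.isSymmetric_B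
  pos := (S.rhoMin_mem hΩ).1.trans_le (S.rhoMin_le_omegaMax hΩ)
  norm_apply_le := S.norm_Omega_apply_le
  mul_norm_sq_le _ := S.bMin_mul_norm_sq_le
  strength_pos := (div_nonneg (mul_nonneg zero_le_two S.omegaMax_nonneg) S.bMin_pos.le).trans_lt
    (S.two_mul_omegaMax_div_bMin_lt hΩ hβ)
  two_mul_lt := (div_lt_iff₀ S.bMin_pos).1 (S.two_mul_omegaMax_div_bMin_lt hΩ hβ)

theorem omegaMax_mul_ratio_le_c (h : IsOverdamped S.Omega S.B S.omegaMax S.bMin β) :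
    S.omegaMax * (2 * S.omegaMax / (β * S.bMin)) ≤ S.c β := by
  have hω := h.pos
  have hd : 0 < β * S.bMin - 2 * S.omegaMax := sub_pos.2 h.two_mul_lt
  have hc : S.c β = 2 * S.omegaMax ^ 2 / (β * S.bMin - 2 * S.omegaMax) := by
    have hsub : β - 2 * S.omegaMax / S.bMin = (β * S.bMin - 2 * S.omegaMax) / S.bMin := by
      field_simp [S.bMin_pos.ne']
    rw [c, hsub]
    field_simp [S.bMin_pos.ne']
  calc S.omegaMax * (2 * S.omegaMax / (β * S.bMin)) = 2 * S.omegaMax ^ 2 / (β * S.bMin) := by ring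
    _ ≤ 2 * S.omegaMax ^ 2 / (β * S.bMin - 2 * S.omegaMax) :=
      div_le_div_of_nonneg_left (by positivity) hd (by linarith)
    _ = S.c β := hc.symm

end Parameters

end LagrangianSystem

namespace LagrangianSystem

variable {N : ℕ} {S : LagrangianSystem N} {β : ℝ}

section Loss

theorem spectrum_A_eq_union : spectrum ℂ (S.A β) = S.spectrumZero β ∪ S.spectrumOne β := by
  refine Set.Subset.antisymm (fun ζ hζ ↦ ?_) (Set.union_subset Set.inter_subset_left
    Set.inter_subset_left)
  obtain ⟨b, hb, hbζ⟩ := exists_mem_spectrum_norm_add_le S.isSymmetric_B S.norm_Omega_apply_le hζ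
  by_cases hb0 : b = 0
  · rw [hb0, Complex.ofReal_zero, mul_zero, zero_add] at hbζ
    exact Or.inl ⟨hζ, mem_closedBall_zero_iff.2 hbζ⟩
  · refine Or.inr ⟨hζ, Set.mem_biUnion (x := (b : ℂ)) ⟨hb, by simpa using hb0⟩ ?_⟩
    rwa [mem_closedBall_iff_norm, sub_neg_eq_add, add_comm]

theorem neg_im_nonneg_of_mem_spectrum_A (hβ : 0 ≤ β) {ζ : ℂ} (hζ : ζ ∈ spectrum ℂ (S.A β)) :
    0 ≤ -ζ.im :=
  neg_im_nonneg_of_mem_spectrum S.isSymmetric_Omega S.re_inner_B_nonneg hβ hζ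

theorem neg_im_le_of_mem_spectrumZero {ζ : ℂ} (hζ : ζ ∈ S.spectrumZero β) :
    -ζ.im ≤ S.omegaMax :=
  (neg_le_abs _).trans ((Complex.abs_im_le_norm ζ).trans (mem_closedBall_zero_iff.1 hζ.2))

theorem exists_norm_add_le_of_mem_spectrumOne {ζ : ℂ} (hζ : ζ ∈ S.spectrumOne β) :
    ∃ b : ℝ, S.bMin ≤ b ∧ ‖ζ + ((β * b : ℝ) : ℂ) * Complex.I‖ ≤ S.omegaMax := by
  obtain ⟨b, ⟨hb, hb0⟩, hbζ⟩ := Set.mem_iUnion₂.1 hζ.2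
  lift b to ℝ using im_eq_zero_of_mem_spectrum S.isSymmetric_B hb
  refine ⟨b, S.bMin_le (by simpa using hb0) hb, ?_⟩
  rwa [mem_closedBall_iff_norm, sub_neg_eq_add, mul_assoc, ← Complex.ofReal_mul, mul_comm] at hbζ

theorem abs_re_le_of_mem_spectrumOne {ζ : ℂ} (hζ : ζ ∈ S.spectrumOne β) :
    |ζ.re| ≤ S.omegaMax := by
  obtain ⟨b, -, hb⟩ := exists_norm_add_le_of_mem_spectrumOne hζ
  have hre := (Complex.abs_re_le_norm _).trans hb
  rwa [Complex.add_re, Complex.re_ofReal_mul, Complex.I_re, mul_zero, add_zero] at hre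

variable (h : IsOverdamped S.Omega S.B S.omegaMax S.bMin β)
include h

theorem le_neg_im_of_mem_spectrumOne {ζ : ℂ} (hζ : ζ ∈ S.spectrumOne β) :
    β * S.bMin - S.omegaMax ≤ -ζ.im := by
  obtain ⟨b, hle, hb⟩ := exists_norm_add_le_of_mem_spectrumOne hζ
  have him := (Complex.abs_im_le_norm _).trans hb
  rw [Complex.add_im, Complex.im_ofReal_mul, Complex.I_im, mul_one] at him
  linarith [(abs_le.1 him).2, mul_le_mul_of_nonneg_left hle h.strength_pos.le]

theorem disjoint_spectrumZero_spectrumOne : Disjoint (S.spectrumZero β) (S.spectrumOne β) :=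
  Set.disjoint_left.2 fun ζ hζ₀ hζ₁ ↦ by
    linarith [neg_im_le_of_mem_spectrumZero hζ₀, le_neg_im_of_mem_spectrumOne h hζ₁, h.two_mul_lt]

theorem mem_spectrumZero_of_neg_im_lt {ζ : ℂ} (hζ : ζ ∈ spectrum ℂ (S.A β))
    (him : -ζ.im < β * S.bMin / 2) : ζ ∈ S.spectrumZero β :=
  (spectrum_A_eq_union.subset hζ).resolve_right fun hζ₁ ↦ by
    linarith [le_neg_im_of_mem_spectrumOne h hζ₁, h.two_mul_lt]

theorem spectrumZero_eq : S.spectrumZero β =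
    {ζ | ζ ∈ spectrum ℂ (S.A β) ∧ 0 ≤ -ζ.im ∧ -ζ.im ≤ S.omegaMax} := by
  ext ζ
  constructor
  · exact fun hζ ↦ ⟨hζ.1, neg_im_nonneg_of_mem_spectrum_A h.strength_pos.le hζ.1,
      neg_im_le_of_mem_spectrumZero hζ⟩
  · rintro ⟨hζ, -, him⟩
    exact mem_spectrumZero_of_neg_im_lt h hζ (by linarith [h.two_mul_lt])

theorem spectrumOne_eq : S.spectrumOne β =
    {ζ | ζ ∈ spectrum ℂ (S.A β) ∧ β * S.bMin - S.omegaMax ≤ -ζ.im} := by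
  ext ζ
  constructor
  · exact fun hζ ↦ ⟨hζ.1, le_neg_im_of_mem_spectrumOne h hζ⟩
  · rintro ⟨hζ, him⟩
    refine (spectrum_A_eq_union.subset hζ).resolve_left fun hζ₀ ↦ ?_
    linarith [neg_im_le_of_mem_spectrumZero hζ₀, h.two_mul_lt]

theorem half_abs_re_div_neg_im_le {ζ : ℂ} (hζ : ζ ∈ S.spectrumOne β) :
    (1 / 2) * (|ζ.re| / (-ζ.im)) ≤ (1 / 2) * (S.omegaMax / (β * S.bMin - S.omegaMax)) :=
  mul_le_mul_of_nonneg_left (div_le_div₀ h.pos.le (abs_re_le_of_mem_spectrumOne hζ)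
    (by linarith [h.pos, h.two_mul_lt]) (le_neg_im_of_mem_spectrumOne h hζ)) one_half_pos.le

theorem half_omegaMax_div_lt : (1 / 2) * (S.omegaMax / (β * S.bMin - S.omegaMax)) < 1 / 2 := by
  have hlt : S.omegaMax / (β * S.bMin - S.omegaMax) < 1 :=
    (div_lt_one (by linarith [h.pos, h.two_mul_lt])).2 (by linarith [h.two_mul_lt])
  linarith

theorem IsLossSplitting.eq_spectralSubspace {Hhl Hll : Submodule ℂ (PhaseSpace N)}
    (H : S.IsLossSplitting β Hhl Hll) : Hhl = spectralSubspace (S.A β) (S.spectrumOne β) ∧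
      Hll = spectralSubspace (S.A β) (S.spectrumZero β) := by
  have hdisj := disjoint_spectrumZero_spectrumOne h
  exact ⟨H.spectrum_high.eq_spectralSubspace hdisj.symm H.spectrum_low
      (le_top.trans_eq H.isCompl.sup_eq_top.symm),
    H.spectrum_low.eq_spectralSubspace hdisj H.spectrum_high
      (le_top.trans_eq H.isCompl.symm.sup_eq_top.symm)⟩

theorem isLossSplitting_spectralSubspace :
    S.IsLossSplitting β (spectralSubspace (S.A β) (S.spectrumOne β))
      (spectralSubspace (S.A β) (S.spectrumZero β)) where
  isCompl := by
    refine ⟨disjoint_spectralSubspace _ (disjoint_spectrumZero_spectrumOne h).symm, ?_⟩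
    rw [codisjoint_iff, ← spectralSubspace_union, Set.union_comm, ← spectrum_A_eq_union,
      ← spectralSubspace_univ (S.A β)]
    exact spectralSubspace_congr _ fun ζ hζ ↦ by simp only [hζ, Set.mem_univ]
  spectrum_low := hasRestrictedSpectrum_spectralSubspace Set.inter_subset_left
  spectrum_high := hasRestrictedSpectrum_spectralSubspace Set.inter_subset_left

theorem existsUnique_isLossSplitting :
    ∃! p : Submodule ℂ (PhaseSpace N) × Submodule ℂ (PhaseSpace N),
      S.IsLossSplitting β p.1 p.2 :=
  ⟨(_, _), isLossSplitting_spectralSubspace h, fun _ H ↦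
    Prod.ext (H.eq_spectralSubspace h).1 (H.eq_spectralSubspace h).2⟩

theorem finrank_spectralSubspace_spectrumZero :
    finrank ℂ (spectralSubspace (S.A β) (S.spectrumZero β)) = finrank ℂ (LinearMap.ker S.B) := by
  rw [← h.finrank_spectralSubspace_high_and_low.2]
  refine congrArg (fun W : Submodule ℂ (PhaseSpace N) ↦ finrank ℂ W) <|
    spectralSubspace_congr (S.A β) fun ζ hζ ↦ ⟨fun hζ₀ ↦ ?_, mem_spectrumZero_of_neg_im_lt h hζ⟩
  rw [Set.mem_ofPred_eq]
  linarith [neg_im_le_of_mem_spectrumZero hζ₀, h.two_mul_lt]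

theorem IsLossSplitting.finrank_low {Hhl Hll : Submodule ℂ (PhaseSpace N)}
    (H : S.IsLossSplitting β Hhl Hll) : finrank ℂ Hll + S.R.rank = 2 * N := by
  rw [(H.eq_spectralSubspace h).2, finrank_spectralSubspace_spectrumZero h, S.finrank_ker_B]

theorem IsLossSplitting.finrank_high {Hhl Hll : Submodule ℂ (PhaseSpace N)}
    (H : S.IsLossSplitting β Hhl Hll) : finrank ℂ Hhl = S.R.rank := by
  have hlow := H.finrank_low h
  have hsum := Submodule.finrank_add_eq_of_isCompl H.isCompl
  rw [finrank_phaseSpace] at hsum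
  omega

theorem exists_mem_spectrum_compressedOmega_norm_sub_le {ζ : ℂ} (hζ : ζ ∈ S.spectrumZero β) :
    ∃ ρ : ℝ, (ρ : ℂ) ∈ spectrum ℂ S.compressedOmega ∧ ‖ζ - ρ‖ ≤ S.c β := by
  obtain ⟨ρ, hρ, hρζ⟩ := h.exists_mem_spectrum_compression_norm_sub_le hζ.1
    (by linarith [neg_im_le_of_mem_spectrumZero hζ, h.two_mul_lt])
  exact ⟨ρ, mem_spectrum_of_mem_spectrum_compression _ _ hρ,
    (norm_sub_rev ζ ρ).trans_le (hρζ.trans (S.omegaMax_mul_ratio_le_c h))⟩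

theorem bounds_of_mem_spectrumZero {ζ : ℂ} (hζ : ζ ∈ S.spectrumZero β) :
    (∃ ρ ∈ spectrum ℂ S.compressedOmega, ‖ζ - ρ‖ ≤ S.c β) ∧
      (∃ ρ : ℝ, (ρ : ℂ) ∈ spectrum ℂ S.compressedOmega ∧ |ζ.re - ρ| ≤ S.c β) ∧
      0 ≤ -ζ.im ∧ -ζ.im ≤ S.c β := by
  obtain ⟨ρ, hρ, hρζ⟩ := exists_mem_spectrum_compressedOmega_norm_sub_le h hζ
  have hre := (Complex.abs_re_le_norm _).trans hρζ
  have him := (Complex.abs_im_le_norm _).trans hρζ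
  rw [Complex.sub_re, Complex.ofReal_re] at hre
  rw [Complex.sub_im, Complex.ofReal_im, sub_zero] at him
  exact ⟨⟨ρ, hρ, hρζ⟩, ⟨ρ, hρ, hre⟩, neg_im_nonneg_of_mem_spectrum_A h.strength_pos.le hζ.1,
    (neg_le_abs _).trans him⟩

end Loss

section LowLossSplitting

theorem exists_norm_sub_le_of_mem_rhoDiscs {r : ℝ} {ζ : ℂ} (hζ : ζ ∈ S.rhoDiscs r) :
    ∃ ρ : ℝ, S.rhoMin ≤ |ρ| ∧ ‖ζ - ρ‖ ≤ r := by
  obtain ⟨ρ, ⟨hρ, hρ0⟩, hρζ⟩ := Set.mem_iUnion₂.1 hζ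
  lift ρ to ℝ using im_eq_zero_of_mem_spectrum S.isSymmetric_compressedOmega hρ
  exact ⟨ρ, S.rhoMin_le_abs (by simpa using hρ0) hρ, mem_closedBall_iff_norm.1 hρζ⟩

theorem rhoMin_sub_le_abs_re_of_mem_rhoDiscs {r : ℝ} {ζ : ℂ} (hζ : ζ ∈ S.rhoDiscs r) :
    S.rhoMin - r ≤ |ζ.re| := by
  obtain ⟨ρ, hle, hρ⟩ := exists_norm_sub_le_of_mem_rhoDiscs hζ
  have hre := (Complex.abs_re_le_norm _).trans hρ
  rw [Complex.sub_re, Complex.ofReal_re, abs_sub_comm] at hre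
  linarith [abs_sub_abs_le_abs_sub ρ ζ.re]

theorem abs_im_le_of_mem_rhoDiscs {r : ℝ} {ζ : ℂ} (hζ : ζ ∈ S.rhoDiscs r) : |ζ.im| ≤ r := by
  obtain ⟨ρ, -, hρ⟩ := exists_norm_sub_le_of_mem_rhoDiscs hζ
  have him := (Complex.abs_im_le_norm _).trans hρ
  rwa [Complex.sub_im, Complex.ofReal_im, sub_zero] at him

variable (hΩ : S.compressedOmega ≠ 0) (hβ : S.cInv (S.rhoMin / 2) < β)
include hΩ hβ

theorem half_rhoMin_lt_abs_re_of_mem_rhoDiscs {ζ : ℂ} (hζ : ζ ∈ S.rhoDiscs (S.c β)) :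
    S.rhoMin / 2 < |ζ.re| := by
  linarith [rhoMin_sub_le_abs_re_of_mem_rhoDiscs hζ, S.c_lt hΩ hβ]

theorem spectrumZero_eq_union : S.spectrumZero β =
    (spectrum ℂ (S.A β) ∩ Metric.closedBall 0 (S.c β)) ∪
      (spectrum ℂ (S.A β) ∩ S.rhoDiscs (S.c β)) := by
  have h := S.isOverdamped hΩ hβ
  have hc : S.c β < S.omegaMax := by
    linarith [S.c_lt hΩ hβ, S.rhoMin_le_omegaMax hΩ, (S.rhoMin_mem hΩ).1]
  refine Set.Subset.antisymm (fun ζ hζ ↦ ?_) (Set.union_subset (Set.inter_subset_inter_right _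
    (Metric.closedBall_subset_closedBall hc.le)) fun ζ hζ ↦ ?_)
  · obtain ⟨ρ, hρ, hρζ⟩ := exists_mem_spectrum_compressedOmega_norm_sub_le h hζ
    by_cases hρ0 : ρ = 0
    · rw [hρ0, Complex.ofReal_zero, sub_zero] at hρζ
      exact Or.inl ⟨hζ.1, mem_closedBall_zero_iff.2 hρζ⟩
    · exact Or.inr ⟨hζ.1, Set.mem_biUnion (x := (ρ : ℂ)) ⟨hρ, by simpa using hρ0⟩
        (mem_closedBall_iff_norm.2 hρζ)⟩
  · refine mem_spectrumZero_of_neg_im_lt h hζ.1 ?_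
    linarith [abs_im_le_of_mem_rhoDiscs hζ.2, neg_le_abs ζ.im, h.two_mul_lt]

theorem spectrum_inter_closedBall_eq : spectrum ℂ (S.A β) ∩ Metric.closedBall 0 (S.c β) =
    spectrum ℂ (S.A β) ∩ {ζ | ‖ζ‖ < S.rhoMin / 2} := by
  have hρ := (S.rhoMin_mem hΩ).1
  ext ζ
  refine and_congr_right fun hζ ↦ ⟨fun hζc ↦ (mem_closedBall_zero_iff.1 hζc).trans_lt
    (S.c_lt hΩ hβ), fun (hlt : ‖ζ‖ < _) ↦ ?_⟩
  have hζ₀ : ζ ∈ S.spectrumZero β :=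
    ⟨hζ, mem_closedBall_zero_iff.2 (by linarith [S.rhoMin_le_omegaMax hΩ])⟩
  refine (((spectrumZero_eq_union hΩ hβ).subset hζ₀).resolve_right fun hζ₁ ↦ ?_).2
  linarith [half_rhoMin_lt_abs_re_of_mem_rhoDiscs hΩ hβ hζ₁.2, Complex.abs_re_le_norm ζ]

theorem spectrum_inter_rhoDiscs_eq : spectrum ℂ (S.A β) ∩ S.rhoDiscs (S.c β) =
    spectrum ℂ (S.A β) ∩ {ζ | S.rhoMin / 2 < ‖ζ‖ ∧ ‖ζ‖ ≤ S.omegaMax} := by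
  have hunion := spectrumZero_eq_union hΩ hβ
  ext ζ
  constructor
  · intro hζ
    have hζ₀ : ζ ∈ S.spectrumZero β := hunion.superset (Or.inr hζ)
    exact ⟨hζ.1, (half_rhoMin_lt_abs_re_of_mem_rhoDiscs hΩ hβ hζ.2).trans_le
      (Complex.abs_re_le_norm ζ), mem_closedBall_zero_iff.1 hζ₀.2⟩
  · rintro ⟨hζ, hlt, hle⟩
    refine (hunion.subset ⟨hζ, mem_closedBall_zero_iff.2 hle⟩).resolve_left fun hζc ↦ ?_
    exact hlt.not_ge ((mem_closedBall_zero_iff.1 hζc.2).trans (S.c_lt hΩ hβ).le)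

theorem disjoint_lowLoss : Disjoint (spectrum ℂ (S.A β) ∩ Metric.closedBall 0 (S.c β))
    (spectrum ℂ (S.A β) ∩ S.rhoDiscs (S.c β)) := by
  rw [spectrum_inter_closedBall_eq hΩ hβ, spectrum_inter_rhoDiscs_eq hΩ hβ]
  exact Set.disjoint_left.2 fun ζ hζ₀ hζ₁ ↦ lt_asymm hζ₀.2 hζ₁.2.1

theorem IsLowLossSplitting.eq_spectralSubspace {H0 H1 : Submodule ℂ (PhaseSpace N)}
    (H : S.IsLowLossSplitting β (spectralSubspace (S.A β) (S.spectrumZero β)) H0 H1) :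
    H0 = spectralSubspace (S.A β) (spectrum ℂ (S.A β) ∩ Metric.closedBall 0 (S.c β)) ∧
      H1 = spectralSubspace (S.A β) (spectrum ℂ (S.A β) ∩ S.rhoDiscs (S.c β)) := by
  have hdisj := disjoint_lowLoss hΩ hβ
  have hsup := H.sup_eq
  rw [spectrumZero_eq_union hΩ hβ] at hsup
  exact ⟨H.spectrum_zero.eq_spectralSubspace hdisj H.spectrum_one hsup.ge,
    H.spectrum_one.eq_spectralSubspace hdisj.symm H.spectrum_zero
      (by rw [Set.union_comm, sup_comm, hsup])⟩

theorem isLowLossSplitting_spectralSubspace :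
    S.IsLowLossSplitting β (spectralSubspace (S.A β) (S.spectrumZero β))
      (spectralSubspace (S.A β) (spectrum ℂ (S.A β) ∩ Metric.closedBall 0 (S.c β)))
      (spectralSubspace (S.A β) (spectrum ℂ (S.A β) ∩ S.rhoDiscs (S.c β))) where
  sup_eq := by rw [← spectralSubspace_union, ← spectrumZero_eq_union hΩ hβ]
  disjoint := disjoint_spectralSubspace (S.A β) (disjoint_lowLoss hΩ hβ)
  spectrum_zero := hasRestrictedSpectrum_spectralSubspace Set.inter_subset_left
  spectrum_one := hasRestrictedSpectrum_spectralSubspace Set.inter_subset_left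

theorem existsUnique_isLowLossSplitting :
    ∃! q : Submodule ℂ (PhaseSpace N) × Submodule ℂ (PhaseSpace N),
      S.IsLowLossSplitting β (spectralSubspace (S.A β) (S.spectrumZero β)) q.1 q.2 :=
  ⟨(_, _), isLowLossSplitting_spectralSubspace hΩ hβ, fun _ H ↦
    Prod.ext (H.eq_spectralSubspace hΩ hβ).1 (H.eq_spectralSubspace hΩ hβ).2⟩

theorem norm_le_c_iff {ζ : ℂ} (hζ : ζ ∈ spectrum ℂ (S.A β)) :
    ‖ζ‖ ≤ S.c β ↔
      -ζ.im < β * S.bMin / 2 ∧ -(S.rhoMin / 2) < ζ.re ∧ ζ.re ≤ S.rhoMin / 2 := by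
  have h := S.isOverdamped hΩ hβ
  constructor
  · intro hc
    have hlt := hc.trans_lt (S.c_lt hΩ hβ)
    have hre := abs_lt.1 ((Complex.abs_re_le_norm ζ).trans_lt hlt)
    have him := (Complex.abs_im_le_norm ζ).trans_lt hlt
    exact ⟨by linarith [neg_le_abs ζ.im, S.rhoMin_le_omegaMax hΩ, h.two_mul_lt, h.pos], hre.1,
      hre.2.le⟩
  · rintro ⟨him, hre⟩
    have hζ₀ := mem_spectrumZero_of_neg_im_lt h hζ him
    refine ((spectrumZero_eq_union hΩ hβ).subset hζ₀).elim
      (fun hζc ↦ mem_closedBall_zero_iff.1 hζc.2) fun hζ₁ ↦ ?_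
    exact absurd (abs_le.2 ⟨hre.1.le, hre.2⟩)
      (half_rhoMin_lt_abs_re_of_mem_rhoDiscs hΩ hβ hζ₁.2).not_ge

theorem finrank_spectralSubspace_closedBall :
    finrank ℂ (spectralSubspace (S.A β) (spectrum ℂ (S.A β) ∩ Metric.closedBall 0 (S.c β))) =
      finrank ℂ (LinearMap.ker (compression (LinearMap.ker S.B) S.Omega)) := by
  have h := S.isOverdamped hΩ hβ
  rw [← h.finrank_spectralSubspace_low_strip_eq_finrank_ker
    ((S.omegaMax_mul_ratio_le_c h).trans (S.c_lt hΩ hβ).le) fun μ hμ hμ0 ↦ by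
      linarith [S.rhoMin_le_abs hμ0 (mem_spectrum_of_mem_spectrum_compression _ _ hμ)]]
  refine congrArg (fun W : Submodule ℂ (PhaseSpace N) ↦ finrank ℂ W) <|
    spectralSubspace_congr (S.A β) fun ζ hζ ↦ ?_
  rw [Set.mem_inter_iff, mem_closedBall_zero_iff, norm_le_c_iff hΩ hβ hζ,
    and_iff_right hζ]
  rfl

theorem finrank_spectralSubspace_rhoDiscs :
    finrank ℂ (spectralSubspace (S.A β) (spectrum ℂ (S.A β) ∩ S.rhoDiscs (S.c β))) =
      finrank ℂ (LinearMap.range S.compressedOmega) := by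
  have hzero := finrank_spectralSubspace_closedBall hΩ hβ
  have hlow := finrank_spectralSubspace_spectrumZero (S.isOverdamped hΩ hβ)
  have hsum := finrank_spectralSubspace_union (S.A β) (disjoint_lowLoss hΩ hβ)
  have hrank := (compression (LinearMap.ker S.B) S.Omega).finrank_range_add_finrank_ker
  rw [← spectrumZero_eq_union hΩ hβ] at hsum
  rw [S.finrank_range_compressedOmega_eq_finrank_range_compression]
  omega

end LowLossSplitting

end LagrangianSystem

theorem mainTheorem9 {N : ℕ} (S : LagrangianSystem N)
    (hN : S.R.rank < N) (hΩ : S.compressedOmega ≠ 0)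
    (β : ℝ) (hβ : S.cInv (S.rhoMin / 2) < β) :
    -- the elementary inequalities
    2 * S.omegaMax / S.bMin < β ∧
    S.c β < S.rhoMin / 2 ∧
    S.rhoMin / 2 ≤ S.omegaMax / 2 ∧
    -- splitting of the spectrum of `A(β)`
    spectrum ℂ (S.A β) = S.spectrumZero β ∪ S.spectrumOne β ∧
    Disjoint (S.spectrumZero β) (S.spectrumOne β) ∧
    -- existence and uniqueness of the high-loss and low-loss subspaces
    (∃! p : Submodule ℂ (PhaseSpace N) × Submodule ℂ (PhaseSpace N),
      S.IsLossSplitting β p.1 p.2) ∧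
    ∀ Hhl Hll : Submodule ℂ (PhaseSpace N), S.IsLossSplitting β Hhl Hll →
      -- their dimensions, `N_R` and `2 N - N_R`
      Module.finrank ℂ Hhl = S.R.rank ∧
      Module.finrank ℂ Hll + S.R.rank = 2 * N ∧
      -- dissipative properties of the two subspaces
      HasRestrictedSpectrum (S.A β) Hll
        {ζ | ζ ∈ spectrum ℂ (S.A β) ∧ 0 ≤ -ζ.im ∧ -ζ.im ≤ S.omegaMax} ∧
      HasRestrictedSpectrum (S.A β) Hhl
        {ζ | ζ ∈ spectrum ℂ (S.A β) ∧ β * S.bMin - S.omegaMax ≤ -ζ.im} ∧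
      S.omegaMax < β * S.bMin - S.omegaMax ∧
      (∀ ζ ∈ S.spectrumOne β,
        (1 / 2) * (|ζ.re| / (-ζ.im)) ≤
          (1 / 2) * (S.omegaMax / (β * S.bMin - S.omegaMax))) ∧
      (1 / 2) * (S.omegaMax / (β * S.bMin - S.omegaMax)) < 1 / 2 ∧
      -- eigenvalue bounds in the low-loss subspace
      (∀ ζ ∈ S.spectrumZero β,
        (∃ ρ ∈ spectrum ℂ S.compressedOmega, ‖ζ - ρ‖ ≤ S.c β) ∧
        (∃ ρ : ℝ, (ρ : ℂ) ∈ spectrum ℂ S.compressedOmega ∧ |ζ.re - ρ| ≤ S.c β) ∧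
        0 ≤ -ζ.im ∧ -ζ.im ≤ S.c β) ∧
      -- existence and uniqueness of the splitting of the low-loss subspace
      (∃! q : Submodule ℂ (PhaseSpace N) × Submodule ℂ (PhaseSpace N),
        S.IsLowLossSplitting β Hll q.1 q.2) ∧
      ∀ H0 H1 : Submodule ℂ (PhaseSpace N), S.IsLowLossSplitting β Hll H0 H1 →
        HasRestrictedSpectrum (S.A β) H1
          (spectrum ℂ (S.A β) ∩ {ζ | S.rhoMin / 2 < ‖ζ‖ ∧ ‖ζ‖ ≤ S.omegaMax}) ∧
        HasRestrictedSpectrum (S.A β) H0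
          (spectrum ℂ (S.A β) ∩ {ζ | ‖ζ‖ < S.rhoMin / 2}) ∧
        Module.finrank ℂ H1 = Module.finrank ℂ (LinearMap.range S.compressedOmega) ∧
        Module.finrank ℂ H0 + Module.finrank ℂ H1 + S.R.rank = 2 * N ∧
        (LinearMap.ker (Matrix.toLin' (S.R.map Complex.ofReal)) ⊓
            LinearMap.ker (Matrix.toLin' (S.η.map Complex.ofReal)) = ⊥ →
          Module.finrank ℂ H1 = 2 * (N - S.R.rank)) := by
  have h := S.isOverdamped hΩ hβ
  have hρω := S.rhoMin_le_omegaMax hΩ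
  refine ⟨S.two_mul_omegaMax_div_bMin_lt hΩ hβ, S.c_lt hΩ hβ, by linarith,
    LagrangianSystem.spectrum_A_eq_union, LagrangianSystem.disjoint_spectrumZero_spectrumOne h,
    LagrangianSystem.existsUnique_isLossSplitting h, fun Hhl Hll H ↦ ?_⟩
  have hdim := H.finrank_low h
  refine ⟨H.finrank_high h, hdim, LagrangianSystem.spectrumZero_eq h ▸ H.spectrum_low,
    LagrangianSystem.spectrumOne_eq h ▸ H.spectrum_high, by linarith [h.two_mul_lt],
    fun _ ↦ LagrangianSystem.half_abs_re_div_neg_im_le h, LagrangianSystem.half_omegaMax_div_lt h,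
    fun _ ↦ LagrangianSystem.bounds_of_mem_spectrumZero h, ?_⟩
  obtain ⟨-, rfl⟩ := H.eq_spectralSubspace h
  refine ⟨LagrangianSystem.existsUnique_isLowLossSplitting hΩ hβ, fun H0 H1 H' ↦ ?_⟩
  have hrank : finrank ℂ H1 = finrank ℂ (LinearMap.range S.compressedOmega) := by
    rw [(H'.eq_spectralSubspace hΩ hβ).2, LagrangianSystem.finrank_spectralSubspace_rhoDiscs hΩ hβ]
  refine ⟨LagrangianSystem.spectrum_inter_rhoDiscs_eq hΩ hβ ▸ H'.spectrum_one,
    LagrangianSystem.spectrum_inter_closedBall_eq hΩ hβ ▸ H'.spectrum_zero, hrank, ?_,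
    fun hker ↦ hrank.trans (S.finrank_range_compressedOmega hker)⟩
  have hsum := Submodule.finrank_sup_add_finrank_inf_eq H0 H1
  rw [H'.sup_eq, H'.disjoint.eq_bot, finrank_bot, add_zero] at hsum
  rw [← hsum, hdim]
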